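/- **Conventions.** $\Sigma$ is a finite alphabet containing two distinct symbols $0,1$; $\Sigma^*$ is the set of finite words and $\Sigma^\omega$ the set of infinite sequences over $\Sigma$. A multi-function $f:A\rightrightarrows B$ is given by sets $f(a)\subseteq B$ $(a\in A)$, with $\mathrm{dom}(f)=\{a: f(a)\neq\emptyset\}$; a partial function is a multi-function with at most one value at each point. A generalized multi-representation is a multi-function $\gamma:X\rightrightarrows Y$ with range $Y$; it is a multi-representation of $Y$ if $X=\Sigma^\omega$. A multi-function $f:X_1\times\dots\times X_n\rightrightarrows X_0$ *realizes* $g:Y_1\times\dots\times Y_n\rightrightarrows Y_0$ via generalized multi-representations $\gamma_i:X_i\rightrightarrows Y_i$ if, whenever $y\in\mathrm{dom}(g)$ and $y_j\in\gamma_j(x_j)$ for $1\le j\le n$, we have $f(x)\neq\emptyset$ and $g(y)\cap\gamma_0(x_0)\neq\emptyset$ for every $x_0\in f(x)$. A partial function from $(\Sigma^\omega)^n$ to $\Sigma^\omega$ (or to $\Sigma^*$) is *computable* if it is extended by the function computed by a Type-2 machine: a Turing machine with $n$ one-way read-only input tapes, finitely many work tapes and a one-way output tape, whose value is the infinite sequence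 it writes while computing forever (respectively, the word on the output tape when it halts). It is *continuous* if it is continuous on its domain, where $\Sigma^\omega$ carries the Cantor topology and $\Sigma^*$ the discrete topology. A multi-function $f:Z_1\times\dots\times Z_n\rightrightarrows Z_0$ is $(\delta_1,\dots,\delta_n,\delta_0)$-computable (continuous), where $\delta_i$ is a multi-representation of $Z_i$, if it is realized via $(\delta_1,\dots,\delta_n,\delta_0)$ by a computable (continuous) partial function from $(\Sigma^\omega)^n$ to $\Sigma^\omega$. A partial function $f$ from $Z_1\times\dots\times Z_n$ to $\Sigma^*$ is $(\delta_1,\dots,\delta_n,\mathrm{id}_{\Sigma^*})$-computable (continuous) if it is realized via $(\delta_1,\dots,\delta_n,\mathrm{id}_{\Sigma^*})$ by a computable (continuous) partial function from $(\Sigma^\omega)^n$ to $\Sigma^*$. **Machines.** A generalized Turing machine $\mathbf P$ has a finite set of labels with an initial label $l_0$ and a final label $l_f$, a finite work alphabet $\Gamma$ with a blank symbol, numbers $k\le L$, and for each tape $i\in\{0,\dots,L\}$ a set $Z_i$ disjoint from $\Gamma$; tapes $1,\dots,k$ are the input tapes and tape $0$ is the output tape. Tapes are two-way infinite, and every cell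 of tape $i$ holds an element of $\Gamma\cup Z_i$. To every label $l\ne l_f$ one statement is attached: move the head of tape $i$ one cell to the right or to the left; write $a\in\Gamma$ under the head of tape $i$; branch according to whether $a\in\Gamma$ is scanned on tape $i$; an assignment $i:=f(i_1,\dots,i_n)$ with a multi-function $f:Z_{i_1}\times\dots\times Z_{i_n}\rightrightarrows Z_i$, which writes any element of $f(x_{i_1},\dots,x_{i_n})$ under the head of tape $i$, where $x_j$ is the symbol scanned on tape $j$; or a test with a partial function $f$ from $Z_{i_1}\times\dots\times Z_{i_n}$ to $\Sigma^*$ with values in $\{0,1\}$, which branches on the value $f(x_{i_1},\dots,x_{i_n})$. After its action each statement goes to a label that it specifies. There is no successor configuration at $l_f$, nor if an assignment or test is applied to arguments that are not in the $Z_{i_j}$ or not in the domain of $f$. Initially the label is $l_0$, all heads are at position $0$, cell $0$ of tape $j$ holds $x_j$ for $1\le j\le k$, and all other cells are blank. A configuration is accepting if its label is $l_f$ and cell $0$ of tape $0$ holds an element of $Z_0$. The multi-function $f_{\mathbf P}:Z_1\times\dots\times Z_k\rightrightarrows Z_0$ is defined by: $x_0\in f_{\mathbf P}(x_1,\dots,x_k)$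 iff every maximal computation from the initial configuration of $(x_1,\dots,x_k)$ is finite and ends in an accepting configuration, and some computation from it ends in an accepting configuration with $x_0$ in cell $0$ of tape $0$. **Theorem.** Let $\mathbf P$ be a generalized Turing machine as above, and for $0\le i\le L$ let $\delta_i:\Sigma^\omega\rightrightarrows Z_i$ be a multi-representation of $Z_i$. 1. If for every assignment $i:=f(i_1,\dots,i_n)$ of $\mathbf P$ the multi-function $f$ is $(\delta_{i_1},\dots,\delta_{i_n},\delta_i)$-computable, and for every test of $\mathbf P$ with partial function $f$ on tapes $i_1,\dots,i_n$ the function $f$ is $(\delta_{i_1},\dots,\delta_{i_n},\mathrm{id}_{\Sigma^*})$-computable, then $f_{\mathbf P}$ is $(\delta_1,\dots,\delta_k,\delta_0)$-computable. 2. The same holds with "continuous" in place of "computable" throughout. -/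

import Mathlib

universe u v s

/-- A multi-function from `A` to `B`, given by its value sets; `a` is in the domain of `f` iff
`f a` is non-empty. -/
abbrev MultiFun (A : Type*) (B : Type*) := A → Set B

/-- A partial function regarded as a multi-function. -/
def PFun.toMultiFun {A B : Type*} (f : A →. B) : MultiFun A B := fun a => {b | b ∈ f a}

/-- `f` realizes `g` via `(γ 0, …, γ (n-1), γ₀)`. -/
def Realizes {n : ℕ} {X Y : Fin n → Type*} {X₀ Y₀ : Type*}
    (γ : ∀ i, MultiFun (X i) (Y i)) (γ₀ : MultiFun X₀ Y₀)
    (f : MultiFun (∀ i, X i) X₀) (g : MultiFun (∀ i, Y i) Y₀) : Prop :=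
  ∀ (x : ∀ i, X i) (y : ∀ i, Y i), (∀ i, y i ∈ γ i (x i)) → (g y).Nonempty →
    (f x).Nonempty ∧ ∀ x₀ ∈ f x, (g y ∩ γ₀ x₀).Nonempty

/-- A multi-representation of `Z`: a multi-function from the infinite sequences over the alphabet
`σ` to `Z` with range `Z`. -/
structure MultiRep (σ : Type s) (Z : Type u) where
  /-- the set of objects named by a sequence -/
  toFun : MultiFun (ℕ → σ) Z
  /-- every object has a name -/
  range_eq : ∀ z, ∃ p, z ∈ toFun p

/-! ### Type-2 machines -/

/-- The instruction attached to a state of a Type-2 machine with alphabet `σ`, `k` input tapes,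
`m` work tapes, work alphabet `Γ` and state set `Q`. The input tapes are read-only and one-way,
the output tape is one-way and write-only. -/
inductive Type2Instr (σ : Type s) (k m : ℕ) (Γ Q : Type)
  /-- halt -/
  | halt
  /-- branch on the symbol scanned by the head of input tape `j` -/
  | inBranch (j : Fin k) (next : σ → Q)
  /-- move the head of input tape `j` one cell to the right -/
  | inRight (j : Fin k) (next : Q)
  /-- branch on the symbol scanned by the head of work tape `i` -/
  | branch (i : Fin m) (next : Γ → Q)
  /-- move the head of work tape `i` one cell to the right -/
  | right (i : Fin m) (next : Q)
  /-- move the head of work tape `i` one cell to the left -/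
  | left (i : Fin m) (next : Q)
  /-- write `a` on the cell scanned by the head of work tape `i` -/
  | write (i : Fin m) (a : Γ) (next : Q)
  /-- write `a` on the output tape and move the output head to the right -/
  | out (a : σ) (next : Q)

/-- A Type-2 machine with `k` input tapes, all of which carry infinite sequences over `σ`. -/
structure Type2Machine (σ : Type s) (k : ℕ) where
  /-- states -/
  Q : Type
  /-- work alphabet -/
  Γ : Type
  finite_Q : Finite Q
  finite_Γ : Finite Γ
  /-- number of work tapes -/
  m : ℕ
  /-- blank symbol -/
  blank : Γ
  /-- initial state -/
  start : Q
  /-- the program -/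
  instr : Q → Type2Instr σ k m Γ Q

namespace Type2Machine

variable {σ : Type s} {k : ℕ}

/-- Configurations: state, input head positions, inscriptions and head positions of the work
tapes, and the word written on the output tape so far. -/
structure Config (M : Type2Machine σ k) where
  state : M.Q
  inPos : Fin k → ℕ
  tape : Fin M.m → ℤ → M.Γ
  head : Fin M.m → ℤ
  output : List σ

/-- The initial configuration. -/
def init (M : Type2Machine σ k) : M.Config where
  state := M.start
  inPos := fun _ => 0
  tape := fun _ _ => M.blank
  head := fun _ => 0
  output := []

/-- One step on input `p`; the value is `none` iff the machine has halted. -/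
def step (M : Type2Machine σ k) (p : Fin k → ℕ → σ) (c : M.Config) : Option M.Config :=
  match M.instr c.state with
  | .halt => none
  | .inBranch j next => some { c with state := next (p j (c.inPos j)) }
  | .inRight j next =>
      some { c with state := next, inPos := Function.update c.inPos j (c.inPos j + 1) }
  | .branch i next => some { c with state := next (c.tape i (c.head i)) }
  | .right i next =>
      some { c with state := next, head := Function.update c.head i (c.head i + 1) }
  | .left i next =>
      some { c with state := next, head := Function.update c.head i (c.head i - 1) }
  | .write i a next =>
      some { c with
        state := next
        tape := Function.update c.tape i (Function.update (c.tape i) (c.head i) a) }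
  | .out a next => some { c with state := next, output := c.output ++ [a] }

/-- The configuration after `n` steps on input `p`, if the machine has not halted before. -/
def run (M : Type2Machine σ k) (p : Fin k → ℕ → σ) : ℕ → Option M.Config
  | 0 => some M.init
  | n + 1 => (M.run p n).bind (M.step p)

/-- `f_M(p) = w` for the output type of finite words: on input `p` the machine halts with `w` on
the output tape. -/
def YieldsWord (M : Type2Machine σ k) (p : Fin k → ℕ → σ) (w : List σ) : Prop :=
  ∃ n c, M.run p n = some c ∧ M.step p c = none ∧ c.output = w

/-- `f_M(p) = q` for the output type of infinite sequences: on input `p` the machine computes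
forever and writes `q` on the output tape. -/
def YieldsSeq (M : Type2Machine σ k) (p : Fin k → ℕ → σ) (q : ℕ → σ) : Prop :=
  (∀ n, (M.run p n).isSome) ∧
    ∀ i, ∃ n c, M.run p n = some c ∧ c.output[i]? = some (q i)

end Type2Machine

/-! ### Computable and continuous functions on sequences -/

section Functions

variable {σ : Type s} {n : ℕ}

/-- A partial function from `n`-tuples of sequences to sequences is computable iff it is extended
by the function of some Type-2 machine. -/
def ComputableToSeq (g : (Fin n → ℕ → σ) →. (ℕ → σ)) : Prop :=
  ∃ M : Type2Machine σ n, ∀ p, ∀ q ∈ g p, M.YieldsSeq p q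

/-- A partial function from `n`-tuples of sequences to words is computable iff it is extended by
the function of some Type-2 machine. -/
def ComputableToWord (g : (Fin n → ℕ → σ) →. List σ) : Prop :=
  ∃ M : Type2Machine σ n, ∀ p, ∀ q ∈ g p, M.YieldsWord p q

/-- Continuity, on its domain, of a partial function from tuples of sequences to sequences, where
sequences carry the Cantor topology (the product of discrete topologies). -/
def ContinuousToSeq (g : (Fin n → ℕ → σ) →. (ℕ → σ)) : Prop :=
  letI : TopologicalSpace σ := ⊥
  Continuous g.asSubtype

/-- Continuity, on its domain, of a partial function from tuples of sequences to words, where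
the set of words is discrete. -/
def ContinuousToWord (g : (Fin n → ℕ → σ) →. List σ) : Prop :=
  letI : TopologicalSpace σ := ⊥
  @Continuous g.Dom (List σ) inferInstance ⊥ g.asSubtype

variable {Y : Fin n → Type u} {Y₀ : Type v}

/-- `f` is `(δ 0, …, δ (n-1), δ₀)`-computable: it has a computable realization. -/
def RelComputable (δ : ∀ j, MultiRep σ (Y j)) (δ₀ : MultiRep σ Y₀)
    (f : MultiFun (∀ j, Y j) Y₀) : Prop :=
  ∃ g : (Fin n → ℕ → σ) →. (ℕ → σ), ComputableToSeq g ∧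
    Realizes (fun j => (δ j).toFun) δ₀.toFun g.toMultiFun f

/-- `f` is `(δ 0, …, δ (n-1), δ₀)`-continuous: it has a continuous realization. -/
def RelContinuous (δ : ∀ j, MultiRep σ (Y j)) (δ₀ : MultiRep σ Y₀)
    (f : MultiFun (∀ j, Y j) Y₀) : Prop :=
  ∃ g : (Fin n → ℕ → σ) →. (ℕ → σ), ContinuousToSeq g ∧
    Realizes (fun j => (δ j).toFun) δ₀.toFun g.toMultiFun f

/-- The word-valued partial function `f` is `(δ 0, …, δ (n-1), id)`-computable, where `id` is the
identity notation of the set of words. -/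
def RelWordComputable (δ : ∀ j, MultiRep σ (Y j)) (f : (∀ j, Y j) →. List σ) : Prop :=
  ∃ g : (Fin n → ℕ → σ) →. List σ, ComputableToWord g ∧
    Realizes (fun j => (δ j).toFun) (fun x : List σ => {x}) g.toMultiFun f.toMultiFun

/-- The word-valued partial function `f` is `(δ 0, …, δ (n-1), id)`-continuous, where `id` is the
identity notation of the set of words. -/
def RelWordContinuous (δ : ∀ j, MultiRep σ (Y j)) (f : (∀ j, Y j) →. List σ) : Prop :=
  ∃ g : (Fin n → ℕ → σ) →. List σ, ContinuousToWord g ∧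
    Realizes (fun j => (δ j).toFun) (fun x : List σ => {x}) g.toMultiFun f.toMultiFun

end Functions

/-! ### Generalized Turing machines -/

/-- Statements of a generalized Turing machine with tapes `0, …, L`, tape sets `X i`, work alphabet
`Γ` and labels `Lab`; `zero` and `one` are the symbols `0` and `1` of the alphabet `σ`. -/
inductive GTMStmt (σ : Type s) (zero one : σ) {L : ℕ} (X : Fin (L + 1) → Type u)
    (Γ Lab : Type v)
  /-- `(i, right, l')` -/
  | right (i : Fin (L + 1)) (l' : Lab)
  /-- `(i, left, l')` -/
  | left (i : Fin (L + 1)) (l' : Lab)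
  /-- `(i := a, l')` -/
  | write (i : Fin (L + 1)) (a : Γ) (l' : Lab)
  /-- `(i, if a then l', else l'')` -/
  | branch (i : Fin (L + 1)) (a : Γ) (l' l'' : Lab)
  /-- `(i := f(i₁, …, iₙ), l')` -/
  | assign {n : ℕ} (i : Fin (L + 1)) (idx : Fin n → Fin (L + 1))
      (f : MultiFun (∀ j, X (idx j)) (X i)) (l' : Lab)
  /-- `(if f(i₁, …, iₙ) then l', else l'')`, where `f` has values in `{0, 1}` -/
  | test {n : ℕ} (idx : Fin n → Fin (L + 1)) (f : (∀ j, X (idx j)) →. List σ)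
      (hf : ∀ x, ∀ y ∈ f x, y = [zero] ∨ y = [one]) (l' l'' : Lab)

/-- A generalized Turing machine with tapes `0, …, L` carrying the sets `X i`, of which tapes
`1, …, k` are the input tapes and tape `0` is the output tape. -/
structure GTM (σ : Type s) (zero one : σ) (k : ℕ) {L : ℕ} (X : Fin (L + 1) → Type u) where
  /-- labels -/
  Lab : Type v
  /-- work alphabet -/
  Γ : Type v
  finite_Lab : Finite Lab
  finite_Γ : Finite Γ
  k_le : k ≤ L
  /-- initial label -/
  l₀ : Lab
  /-- final label -/
  lf : Lab
  /-- blank symbol -/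
  blank : Γ
  /-- the statement of a non-final label -/
  stm : ∀ l : Lab, l ≠ lf → GTMStmt σ zero one X Γ Lab

namespace GTM

variable {σ : Type s} {zero one : σ} {k L : ℕ} {X : Fin (L + 1) → Type u}

/-- The number of the `j`-th input tape: for `j = 0, …, k - 1` this is tape `j + 1`. -/
def inTape (P : GTM.{u, v, s} σ zero one k X) (j : Fin k) : Fin (L + 1) :=
  ⟨j.val + 1, by have := P.k_le; omega⟩

/-- Configurations. Every cell of tape `i` contains an element of the disjoint union of `Γ` and
`X i`. -/
structure Config (P : GTM.{u, v, s} σ zero one k X) where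
  label : P.Lab
  tape : ∀ i : Fin (L + 1), ℤ → P.Γ ⊕ X i
  head : Fin (L + 1) → ℤ

/-- The content of the cell scanned by the head of tape `i`. -/
def Config.scan {P : GTM.{u, v, s} σ zero one k X} (c : P.Config) (i : Fin (L + 1)) :
    P.Γ ⊕ X i :=
  c.tape i (c.head i)

/-- Replace the label. -/
def Config.goto {P : GTM.{u, v, s} σ zero one k X} (c : P.Config) (l : P.Lab) : P.Config :=
  { c with label := l }

/-- Move the head of tape `i` to position `m`. -/
def Config.setHead {P : GTM.{u, v, s} σ zero one k X} (c : P.Config) (i : Fin (L + 1))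
    (m : ℤ) : P.Config :=
  { c with head := Function.update c.head i m }

/-- Write `y` under the head of tape `i`. -/
def Config.setCell {P : GTM.{u, v, s} σ zero one k X} (c : P.Config) (i : Fin (L + 1))
    (y : P.Γ ⊕ X i) : P.Config :=
  { c with tape := Function.update c.tape i (Function.update (c.tape i) (c.head i) y) }

/-- The effect of a statement: `c'` is a possible successor of `c`. -/
def Effect (P : GTM.{u, v, s} σ zero one k X) (c c' : P.Config) :
    GTMStmt σ zero one X P.Γ P.Lab → Prop
  | .right i l' => c' = (c.setHead i (c.head i + 1)).goto l'
  | .left i l' => c' = (c.setHead i (c.head i - 1)).goto l'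
  | .write i a l' => c' = (c.setCell i (Sum.inl a)).goto l'
  | .branch i a l' l'' =>
      (c.scan i = Sum.inl a ∧ c' = c.goto l') ∨ (c.scan i ≠ Sum.inl a ∧ c' = c.goto l'')
  | .assign i idx f l' =>
      ∃ x : ∀ j, X (idx j), (∀ j, c.scan (idx j) = Sum.inr (x j)) ∧
        ∃ y ∈ f x, c' = (c.setCell i (Sum.inr y)).goto l'
  | .test idx f _ l' l'' =>
      ∃ x : ∀ j, X (idx j), (∀ j, c.scan (idx j) = Sum.inr (x j)) ∧
        (([zero] ∈ f x ∧ c' = c.goto l') ∨ ([one] ∈ f x ∧ c' = c.goto l''))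

/-- The successor relation on configurations. -/
def Step (P : GTM.{u, v, s} σ zero one k X) (c c' : P.Config) : Prop :=
  ∃ h : c.label ≠ P.lf, P.Effect c c' (P.stm c.label h)

/-- Accepting configurations. -/
def Accepting (P : GTM.{u, v, s} σ zero one k X) (c : P.Config) : Prop :=
  c.label = P.lf ∧ ∃ x : X 0, c.tape 0 0 = Sum.inr x

/-- The initial configuration: cell `0` of the `j`-th input tape contains `x j`, all other cells
are blank, and all heads are on position `0`. -/
def initial (P : GTM.{u, v, s} σ zero one k X) (x : ∀ j, X (P.inTape j)) : P.Config where
  label := P.l₀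
  tape := fun i m =>
    if h : m = 0 ∧ 0 < i.val ∧ i.val ≤ k then
      Sum.inr (cast
        (congrArg X (Fin.ext (Nat.sub_add_cancel h.2.1) :
          P.inTape ⟨i.val - 1, by omega⟩ = i))
        (x ⟨i.val - 1, by omega⟩))
    else Sum.inl P.blank
  head := fun _ => 0

/-- Every maximal computation with first configuration `c₀` is accepting: there is no infinite
computation from `c₀`, and the last configuration of every finite computation from `c₀` that cannot
be continued is accepting. -/
def AllAccepting (P : GTM.{u, v, s} σ zero one k X) (c₀ : P.Config) : Prop :=
  (¬ ∃ κ : ℕ → P.Config, κ 0 = c₀ ∧ ∀ n, P.Step (κ n) (κ (n + 1))) ∧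
    ∀ c, Relation.ReflTransGen P.Step c₀ c → (¬ ∃ c', P.Step c c') → P.Accepting c

/-- The multi-function computed by the machine. -/
def fn (P : GTM.{u, v, s} σ zero one k X) : MultiFun (∀ j, X (P.inTape j)) (X 0) := fun x =>
  {x₀ | P.AllAccepting (P.initial x) ∧
    ∃ c, Relation.ReflTransGen P.Step (P.initial x) c ∧ P.Accepting c ∧
      c.tape 0 0 = Sum.inr x₀}

/-- The machine is `(δ i)`-computable: every multi-function in an assignment and every partial
function in a test is relatively computable. -/
def IsComputable (P : GTM.{u, v, s} σ zero one k X) (δ : ∀ i, MultiRep σ (X i)) : Prop :=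
  ∀ (l : P.Lab) (h : l ≠ P.lf),
    match P.stm l h with
    | .assign i idx f _ => RelComputable (fun j => δ (idx j)) (δ i) f
    | .test idx f _ _ _ => RelWordComputable (fun j => δ (idx j)) f
    | _ => True

/-- The machine is `(δ i)`-continuous: every multi-function in an assignment and every partial
function in a test is relatively continuous. -/
def IsContinuous (P : GTM.{u, v, s} σ zero one k X) (δ : ∀ i, MultiRep σ (X i)) : Prop :=
  ∀ (l : P.Lab) (h : l ≠ P.lf),
    match P.stm l h with
    | .assign i idx f _ => RelContinuous (fun j => δ (idx j)) (δ i) f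
    | .test idx f _ _ _ => RelWordContinuous (fun j => δ (idx j)) f
    | _ => True

end GTM

/-! Every statement of `P` acts on names through a function on sequences, and such a function is
governed by what it does to finite prefixes. The proof replaces objects by names and then names by
finite words.

Names (`GTM.realizes_outputs`). Substituting realizations for the statements of `P` gives a machine
on sequences. If `P.fn x` is non-empty, every computation of this machine on names of `x` describes
some computation of `P` on `x`: when a realization returns a name `r`, some admissible value of the
multi-function has the name `r`, and the described computation chooses that value. All computations
of `P` on `x` are finite and accepting, so the machine on names can neither get stuck nor run
forever, and it ends with a name of an element of `P.fn x`.

Words (`approximatesSeq_approxOutput`). A function on words approximates `g` if, on prefixes of an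
argument, it yields prefixes of the value, and arbitrarily long ones as the precision and the given
prefixes grow. Replacing each function of the machine on names by an approximation gives a machine
on words, which is run for `t` steps at precision `t`. It waits at a test whose value is not yet
known, so it never produces a wrong symbol. An accepting computation is finite, so the length
demanded of the output can be propagated back, step by step, to a length demanded of the input.
Hence the function computed on names is approximated as well.

It remains to translate the hypotheses into approximations, and an approximation back into the
conclusion. Continuous functions are those with an arbitrary approximation
(`ContinuousToSeq.exists_approximates`, `ApproximatesSeq.continuousToSeq`). Computable functions are
those with a primitive recursive one (`ComputableToSeq.exists_approximates`,
`ApproximatesSeq.computableToSeq`), and iterating a primitive recursive step preserves this. One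
direction runs a Type-2 machine for `t` steps on words. The other needs an actual Type-2 machine:
`exists_type2Machine_loop` repeatedly reads a symbol from each input, evaluates a primitive
recursive rule with the stack machine for partial recursive functions, and writes at most one
further symbol. -/

/-! ### Type-2 programs with an arbitrary state set -/

section FreePrograms

variable {σ : Type s} {k m : ℕ} {Γ Q : Type}

/-- The configurations of a Type-2 program whose state set need not be finite. -/
structure FreeConfig (σ : Type s) (k m : ℕ) (Γ Q : Type) where
  state : Q
  inPos : Fin k → ℕ
  tape : Fin m → ℤ → Γ
  head : Fin m → ℤ
  output : List σ

/-- One step of a Type-2 program whose state set need not be finite. -/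
def freeStep (instr : Q → Type2Instr σ k m Γ Q) (p : Fin k → ℕ → σ)
    (c : FreeConfig σ k m Γ Q) : Option (FreeConfig σ k m Γ Q) :=
  match instr c.state with
  | .halt => none
  | .inBranch j next => some { c with state := next (p j (c.inPos j)) }
  | .inRight j next =>
      some { c with state := next, inPos := Function.update c.inPos j (c.inPos j + 1) }
  | .branch i next => some { c with state := next (c.tape i (c.head i)) }
  | .right i next =>
      some { c with state := next, head := Function.update c.head i (c.head i + 1) }
  | .left i next =>
      some { c with state := next, head := Function.update c.head i (c.head i - 1) }
  | .write i a next =>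
      some { c with
        state := next
        tape := Function.update c.tape i (Function.update (c.tape i) (c.head i) a) }
  | .out a next => some { c with state := next, output := c.output ++ [a] }

/-- `c'` is reached from `c` in finitely many steps. -/
abbrev FreeReach (instr : Q → Type2Instr σ k m Γ Q) (p : Fin k → ℕ → σ)
    (c c' : FreeConfig σ k m Γ Q) : Prop :=
  Relation.ReflTransGen (fun a b => freeStep instr p a = some b) c c'

/-- The states to which an instruction may lead. -/
def Type2Instr.targets : Type2Instr σ k m Γ Q → Set Q
  | .halt => ∅
  | .inBranch _ next => Set.range next
  | .inRight _ next => {next}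
  | .branch _ next => Set.range next
  | .right _ next => {next}
  | .left _ next => {next}
  | .write _ _ next => {next}
  | .out _ next => {next}

/-- Rename the states of an instruction. -/
def Type2Instr.map {Q' : Type} (f : Q → Q') :
    Type2Instr σ k m Γ Q → Type2Instr σ k m Γ Q'
  | .halt => .halt
  | .inBranch j next => .inBranch j fun x => f (next x)
  | .inRight j next => .inRight j (f next)
  | .branch i next => .branch i fun x => f (next x)
  | .right i next => .right i (f next)
  | .left i next => .left i (f next)
  | .write i a next => .write i a (f next)
  | .out a next => .out a (f next)

open Classical in
/-- The restriction of a program to a finite set of states. -/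
noncomputable def restrictProgram [Finite Γ] (instr : Q → Type2Instr σ k m Γ Q) (blank : Γ)
    (S : Set Q) (hS : S.Finite) (q₀ : S) : Type2Machine σ k where
  Q := S
  Γ := Γ
  finite_Q := hS
  finite_Γ := inferInstance
  m := m
  blank := blank
  start := q₀
  instr := fun q => (instr q).map fun q' => if h : q' ∈ S then ⟨q', h⟩ else q₀

variable [Finite Γ] {instr : Q → Type2Instr σ k m Γ Q} {blank : Γ} {S : Set Q} {hS : S.Finite}
  {q₀ : S} {p : Fin k → ℕ → σ}

/-- Forget that the state belongs to the chosen finite set. -/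
def Type2Machine.Config.toFree (c : (restrictProgram instr blank S hS q₀).Config) :
    FreeConfig σ k m Γ Q :=
  ⟨Subtype.val (p := (· ∈ S)) c.state, c.inPos, c.tape, c.head, c.output⟩

/-- Since `S` is closed under the targets of instructions, the default state `q₀` in the renaming is
never used, and the restricted program makes exactly the free step. -/
theorem restrictProgram_step (hcl : ∀ q ∈ S, (instr q).targets ⊆ S)
    (c : (restrictProgram instr blank S hS q₀).Config) {d : FreeConfig σ k m Γ Q}
    (h : freeStep instr p c.toFree = some d) :
    ∃ c', (restrictProgram instr blank S hS q₀).step p c = some c' ∧ c'.toFree = d := by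
  obtain ⟨⟨q, hq⟩, pos, tape, head, out⟩ := c
  have h1 := hcl q hq
  simp only [freeStep, Type2Machine.Config.toFree] at h
  simp only [Type2Machine.step, restrictProgram]
  cases hi : instr q <;> simp only [hi] at h h1 <;> simp only [Type2Instr.map]
  · cases h
  all_goals
    cases h
    refine ⟨_, rfl, ?_⟩
    simp only [Type2Machine.Config.toFree]
    rw [dif_pos (h1 (by first | exact Set.mem_singleton _ | exact ⟨_, rfl⟩))]
    try rfl

theorem restrictProgram_reach (hcl : ∀ q ∈ S, (instr q).targets ⊆ S)
    {n : ℕ} {c : (restrictProgram instr blank S hS q₀).Config}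
    (hc : (restrictProgram instr blank S hS q₀).run p n = some c) {d : FreeConfig σ k m Γ Q}
    (h : FreeReach instr p c.toFree d) :
    ∃ n' ≥ n, ∃ c', (restrictProgram instr blank S hS q₀).run p n' = some c' ∧ c'.toFree = d := by
  induction h with
  | refl => exact ⟨n, le_rfl, c, hc, rfl⟩
  | tail _ hs ih =>
    obtain ⟨n', hn, c', hc', rfl⟩ := ih
    obtain ⟨c'', h1, h2⟩ := restrictProgram_step hcl c' hs
    exact ⟨n' + 1, by omega, c'', by simp [Type2Machine.run, hc', h1], h2⟩

theorem Type2Machine.run_isSome_of_le {M : Type2Machine σ k} {n n' : ℕ} (h : n ≤ n')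
    (hn : (M.run p n').isSome) : (M.run p n).isSome := by
  induction n', h using Nat.le_induction with
  | base => exact hn
  | succ n' _ ih =>
    apply ih
    rw [Type2Machine.run] at hn
    exact Option.isSome_of_isSome_bind hn

/-- A program that repeats a non-empty loop, and whose outputs at the beginnings of the loop exhaust
`q`, yields `q`. -/
theorem restrictProgram_yieldsSeq (hcl : ∀ q ∈ S, (instr q).targets ⊆ S) {q : ℕ → σ}
    (Inv : ℕ → FreeConfig σ k m Γ Q → Prop)
    (h0 : ∃ d, FreeReach instr p ⟨q₀, fun _ => 0, fun _ _ => blank, fun _ => 0, []⟩ d ∧ Inv 0 d)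
    (hs : ∀ t d, Inv t d → ∃ d₁ d', freeStep instr p d = some d₁ ∧ FreeReach instr p d₁ d' ∧
      Inv (t + 1) d')
    (hq : ∀ i, ∃ t, ∀ d, Inv t d → d.output[i]? = some (q i)) :
    (restrictProgram instr blank S hS q₀).YieldsSeq p q := by
  set M := restrictProgram instr blank S hS q₀
  -- Each round contains at least one step, so round `t` does not begin before time `t`. This is
  -- what shows that the machine never halts.
  have key : ∀ t, ∃ n ≥ t, ∃ c, M.run p n = some c ∧ Inv t c.toFree := by
    intro t
    induction t with
    | zero =>
      obtain ⟨d, hd, hI⟩ := h0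
      obtain ⟨n, hn, c, hc, rfl⟩ := restrictProgram_reach (n := 0) (c := M.init) hcl rfl hd
      exact ⟨n, hn, c, hc, hI⟩
    | succ t ih =>
      obtain ⟨n, hn, c, hc, hI⟩ := ih
      obtain ⟨d₁, d', h1, h2, h3⟩ := hs t _ hI
      obtain ⟨c₁, hc₁, rfl⟩ := restrictProgram_step hcl c h1
      obtain ⟨n', hn', c', hc', rfl⟩ := restrictProgram_reach (n := n + 1) (c := c₁) hcl
        (by rw [Type2Machine.run, hc]; exact hc₁) h2
      exact ⟨n', by omega, c', hc', h3⟩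
  refine ⟨fun n => ?_, fun i => ?_⟩
  · obtain ⟨n', hn, c, hc, -⟩ := key n
    exact Type2Machine.run_isSome_of_le hn (by simp [hc])
  · obtain ⟨t, ht⟩ := hq i
    obtain ⟨n, -, c, hc, hI⟩ := key t
    exact ⟨n, c, hc, ht _ hI⟩

end FreePrograms

/-! ### Type-2 machines that call partial recursive functions in a loop -/

section CodeLoop

open Turing Turing.PartrecToTM2

/-- The statements of the stack machine that evaluates codes of partial recursive functions. -/
abbrev CodeStmt := TM2.Stmt (fun _ : K' => Γ') Λ' (Option Γ')

/-- The work tape that stores a stack. -/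
def K'.tapeIndex : K' → Fin 4
  | .main => 0
  | .rev => 1
  | .aux => 2
  | .stack => 3

theorem K'.tapeIndex_injective : Function.Injective K'.tapeIndex := by
  intro a b h
  cases a <;> cases b <;> first | rfl | (exfalso; revert h; decide)

/-- The states of the machine that, in a loop, evaluates a code, writes an output symbol, and reads
one symbol from each input tape. -/
inductive LoopState (k A : ℕ) : Type
  /-- execute a statement of the stack machine -/
  | run (q : CodeStmt) (v : Option Γ')
  /-- write a symbol on a stack after moving the head, then continue with `q` -/
  | push (a : Γ') (κ : K') (q : CodeStmt) (v : Option Γ')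
  /-- remove the topmost symbol of a stack, then continue with `q` -/
  | pop (κ : K') (q : CodeStmt) (v : Option Γ')
  /-- collect the symbols of the first number on the main stack -/
  | parse (w : List Γ')
  /-- remove the topmost symbol `a` of the main stack while collecting -/
  | parsed (w : List Γ') (a : Γ')
  /-- write an output symbol -/
  | emit (i : Fin (A + 1))
  /-- read the symbol under the head of input tape `j` -/
  | read (j : Fin k) (r : Fin k → Fin (A + 1))
  /-- move the head of input tape `j` -/
  | move (j : Fin k) (r : Fin k → Fin (A + 1))

namespace LoopState

variable {σ : Type s} {k A : ℕ}

/-- The first state of the evaluation of a code. -/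
def start (c : ToPartrec.Code) : LoopState k A := run (tr (trNormal c .halt)) none

/-- Read the input tapes from number `j` on, then evaluate the code chosen by the symbols read. -/
def readFrom (code : (Fin k → Fin (A + 1)) → ToPartrec.Code) (j : ℕ)
    (r : Fin k → Fin (A + 1)) : LoopState k A :=
  if h : j < k then read ⟨j, h⟩ r else start (code r)

/-- The state after the first number has been removed from the main stack. -/
def afterParse (code : (Fin k → Fin (A + 1)) → ToPartrec.Code)
    (dec : List Γ' → Option (Fin (A + 1))) (w : List Γ') : LoopState k A :=
  match dec w with
  | some i => emit i
  | none => readFrom code 0 fun _ => 0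

/-- The program of the loop. -/
def instr (e : σ ≃ Fin (A + 1)) (code : (Fin k → Fin (A + 1)) → ToPartrec.Code)
    (dec : List Γ' → Option (Fin (A + 1))) (B : ℕ) :
    LoopState k A → Type2Instr σ k 4 (Option Γ') (LoopState k A)
  | run (.push κ f q) v => .right (K'.tapeIndex κ) (push (f v) κ q v)
  | run (.peek κ f q) v => .branch (K'.tapeIndex κ) fun x => run q (f v x)
  | run (.pop κ f q) v => .branch (K'.tapeIndex κ) fun x =>
      match x with
      | none => run q (f v none)
      | some a => pop κ q (f v (some a))
  -- Type-2 instructions include no pure change of state; a branch that ignores the scanned symbol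
  -- serves instead.
  | run (.load f q) v => .branch 0 fun _ => run q (f v)
  | run (.branch f q₁ q₂) v => .branch 0 fun _ => cond (f v) (run q₁ v) (run q₂ v)
  | run (.goto f) v => .branch 0 fun _ => run (tr (f v)) v
  | run .halt _ => .branch 0 fun _ => parse []
  | push a κ q v => .write (K'.tapeIndex κ) (some a) (run q v)
  | pop κ q v => .left (K'.tapeIndex κ) (run q v)
  | parse w => .branch 0 fun x =>
      match x with
      | none => parse w
      | some a => parsed w a
  -- The test `w.length < B` only keeps the set of states finite. With `B` chosen large enough, no
  -- symbol is ever dropped.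
  | parsed w a => .left 0
      (if a = Γ'.cons then afterParse code dec w
        else if w.length < B then parse (w ++ [a]) else parse w)
  | emit i => .out (e.symm i) (readFrom code 0 fun _ => 0)
  | read j r => .inBranch j fun x => move j (Function.update r j (e x))
  | move j r => .inRight j (readFrom code (j + 1) r)

/-- The tapes of a configuration store the stacks `S`. -/
def Stores (S : K' → List Γ') (d : FreeConfig σ k 4 (Option Γ') (LoopState k A)) : Prop :=
  ∀ (κ : K') (i : ℕ), d.tape (K'.tapeIndex κ) (d.head (K'.tapeIndex κ) - i) = (S κ)[i]?

/-- `d'` is reached from `d` without using the input and output tapes, its state is `q`, and its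
tapes store `S`. -/
def Leads (ins : LoopState k A → Type2Instr σ k 4 (Option Γ') (LoopState k A))
    (p : Fin k → ℕ → σ) (d : FreeConfig σ k 4 (Option Γ') (LoopState k A)) (q : LoopState k A)
    (S : K' → List Γ') : Prop :=
  ∃ d', FreeReach ins p d d' ∧ d'.state = q ∧ Stores S d' ∧ d'.inPos = d.inPos ∧
    d'.output = d.output

theorem Leads.head {ins : LoopState k A → Type2Instr σ k 4 (Option Γ') (LoopState k A)}
    {p : Fin k → ℕ → σ} {d d₁ : FreeConfig σ k 4 (Option Γ') (LoopState k A)}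
    {q : LoopState k A} {S : K' → List Γ'} (h : freeStep ins p d = some d₁)
    (hi : d₁.inPos = d.inPos) (ho : d₁.output = d.output) (hl : Leads ins p d₁ q S) :
    Leads ins p d q S := by
  obtain ⟨d', h1, h2, h3, h4, h5⟩ := hl
  exact ⟨d', .head h h1, h2, h3, h4.trans hi, h5.trans ho⟩

theorem Stores.tape_head {S : K' → List Γ'} {d : FreeConfig σ k 4 (Option Γ') (LoopState k A)}
    (h : Stores S d) (κ : K') : d.tape (K'.tapeIndex κ) (d.head (K'.tapeIndex κ)) = (S κ).head? := by
  simpa [List.head?_eq_getElem?] using h κ 0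

theorem Stores.push {S : K' → List Γ'} {d : FreeConfig σ k 4 (Option Γ') (LoopState k A)}
    (h : Stores S d) (κ : K') (a : Γ') (q : LoopState k A) :
    Stores (Function.update S κ (a :: S κ))
      { state := q
        inPos := d.inPos
        tape := Function.update d.tape (K'.tapeIndex κ)
          (Function.update (d.tape (K'.tapeIndex κ)) (d.head (K'.tapeIndex κ) + 1) (some a))
        head := Function.update d.head (K'.tapeIndex κ) (d.head (K'.tapeIndex κ) + 1)
        output := d.output } := by
  intro κ' i
  by_cases hκ : κ' = κ
  · subst hκ
    cases i with
    | zero => simp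
    | succ i =>
      simp only [Function.update_self, List.getElem?_cons_succ]
      rw [Function.update_of_ne (by push_cast; omega), ← h κ' i]
      congr 1
      push_cast
      ring
  · have h1 : K'.tapeIndex κ' ≠ K'.tapeIndex κ := fun h => hκ (K'.tapeIndex_injective h)
    simpa [Function.update_of_ne h1, Function.update_of_ne hκ] using h κ' i

theorem Stores.pop {S : K' → List Γ'} {d : FreeConfig σ k 4 (Option Γ') (LoopState k A)}
    (h : Stores S d) (κ : K') (q : LoopState k A) :
    Stores (Function.update S κ (S κ).tail)
      { state := q
        inPos := d.inPos
        tape := d.tape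
        head := Function.update d.head (K'.tapeIndex κ) (d.head (K'.tapeIndex κ) - 1)
        output := d.output } := by
  intro κ' i
  by_cases hκ : κ' = κ
  · subst hκ
    have := h κ' (i + 1)
    simp only [Function.update_self, List.getElem?_tail]
    rw [← this]
    congr 1
    push_cast
    ring
  · have h1 : K'.tapeIndex κ' ≠ K'.tapeIndex κ := fun h => hκ (K'.tapeIndex_injective h)
    simpa [Function.update_of_ne h1, Function.update_of_ne hκ] using h κ' i

/-- The state that corresponds to a configuration of the stack machine. -/
def ofCfg : TM2.Cfg (fun _ : K' => Γ') Λ' (Option Γ') → LoopState k A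
  | ⟨some l, v, _⟩ => run (tr l) v
  | ⟨none, _, _⟩ => parse []

variable {e : σ ≃ Fin (A + 1)} {code : (Fin k → Fin (A + 1)) → ToPartrec.Code}
  {dec : List Γ' → Option (Fin (A + 1))} {B : ℕ} {p : Fin k → ℕ → σ}

/-- The head of each tape rests on the top of its stack, and the deeper entries lie to its left.
Cells to the right of the head are overwritten before they are scanned again, so a pop need not
erase anything, and a blank under the head means that the stack is empty. -/
theorem leads_run (q : CodeStmt) (v : Option Γ') (S : K' → List Γ')
    (d : FreeConfig σ k 4 (Option Γ') (LoopState k A)) (hd : d.state = run q v)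
    (hS : Stores S d) :
    Leads (instr e code dec B) p d (ofCfg (TM2.stepAux q v S)) (TM2.stepAux q v S).stk := by
  obtain ⟨st, pos, tape, hpos, out⟩ := d
  obtain rfl : st = run q v := hd
  induction q generalizing v S tape hpos with
  | push κ f q ih =>
    refine Leads.head rfl rfl rfl (Leads.head rfl rfl rfl (ih v _ _ _ ?_))
    simpa using hS.push κ (f v) (run q v)
  | peek κ f q ih =>
    refine Leads.head rfl rfl rfl ?_
    have h0 : tape (K'.tapeIndex κ) (hpos (K'.tapeIndex κ)) = (S κ).head? := hS.tape_head κ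
    simp only [h0]
    exact ih _ _ _ _ hS
  | pop κ f q ih =>
    refine Leads.head rfl rfl rfl ?_
    have h0 : tape (K'.tapeIndex κ) (hpos (K'.tapeIndex κ)) = (S κ).head? := hS.tape_head κ
    simp only [h0, TM2.stepAux]
    cases hk : S κ with
    | nil =>
      refine ih _ _ _ _ ?_
      rw [List.tail_nil, ← hk, Function.update_eq_self]
      exact hS
    | cons a l =>
      refine Leads.head rfl rfl rfl (ih _ _ _ _ ?_)
      simpa [hk] using hS.pop κ (run q (f v (some a)))
  | load f q ih => exact Leads.head rfl rfl rfl (ih _ _ _ _ hS)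
  | branch f q₁ q₂ ih₁ ih₂ =>
    refine Leads.head rfl rfl rfl ?_
    simp only [TM2.stepAux]
    cases f v
    · exact ih₂ _ _ _ _ hS
    · exact ih₁ _ _ _ _ hS
  | goto f => exact Leads.head rfl rfl rfl ⟨_, .refl, rfl, hS, rfl, rfl⟩
  | halt => exact Leads.head rfl rfl rfl ⟨_, .refl, rfl, hS, rfl, rfl⟩

/-- The stack machine halts with the list of values on the main stack and the other stacks empty.
This is again the form of an initial configuration, so the result of one evaluation can be passed on
to the next. -/
theorem leads_eval {c : ToPartrec.Code} {v v' : List ℕ} (hc : v' ∈ c.eval v)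
    (d : FreeConfig σ k 4 (Option Γ') (LoopState k A)) (hd : d.state = start c)
    (hS : Stores (K'.elim (trList v) [] [] []) d) :
    Leads (instr e code dec B) p d (parse []) (K'.elim (trList v') [] [] []) := by
  have h1 : PartrecToTM2.halt v' ∈ StateTransition.eval (TM2.step tr) (PartrecToTM2.init c v) := by
    rw [tr_eval]
    exact Part.mem_map _ hc
  have h2 := (StateTransition.mem_eval.1 h1).1
  suffices ∀ C, StateTransition.Reaches (TM2.step tr) (PartrecToTM2.init c v) C →
      Leads (instr e code dec B) p d (ofCfg C) C.stk from this _ h2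
  intro C hC
  induction hC with
  | refl => exact ⟨d, .refl, hd, hS, rfl, rfl⟩
  | @tail C C' _ hs ih =>
    obtain ⟨d', h3, h4, h5, h6, h7⟩ := ih
    obtain ⟨l, w, S⟩ := C
    cases l with
    | none => cases hs
    | some l =>
      cases hs
      obtain ⟨d'', h8, h9, h10, h11, h12⟩ :=
        leads_run (e := e) (code := code) (dec := dec) (B := B) (p := p) (tr l) w S d' h4 h5
      exact ⟨d'', h3.trans h8, h9, h10, h11.trans h6, h12.trans h7⟩

/-- Each number on the stack is closed by `Γ'.cons`, which does not occur among its digits. Popping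
up to the first `Γ'.cons` isolates the first number and leaves the remaining list in place. -/
theorem leads_parse (w u : List Γ') (l : List Γ') (hu : Γ'.cons ∉ u) (hB : w.length + u.length ≤ B)
    (d : FreeConfig σ k 4 (Option Γ') (LoopState k A)) (hd : d.state = parse w)
    (hS : Stores (K'.elim (u ++ Γ'.cons :: l) [] [] []) d) :
    Leads (instr e code dec B) p d (afterParse code dec (w ++ u)) (K'.elim l [] [] []) := by
  obtain ⟨st, pos, tape, hpos, out⟩ := d
  obtain rfl : st = parse w := hd
  induction u generalizing w tape hpos with
  | nil =>
    have h0 : tape 0 (hpos 0) = some Γ'.cons := hS.tape_head .main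
    refine Leads.head rfl rfl rfl ?_
    simp only [h0]
    refine Leads.head rfl rfl rfl ⟨_, .refl, by simp, ?_, rfl, rfl⟩
    simpa [K'.tapeIndex] using hS.pop .main (afterParse code dec w)
  | cons a u ih =>
    have h0 : tape 0 (hpos 0) = some a := hS.tape_head .main
    simp only [List.mem_cons, not_or] at hu
    simp only [List.length_cons] at hB
    refine Leads.head rfl rfl rfl ?_
    simp only [h0]
    refine Leads.head rfl rfl rfl ?_
    rw [if_neg (Ne.symm hu.1), if_pos (by omega), List.append_cons w a u]
    refine ih (w ++ [a]) hu.2 (by simp; omega) _ _ ?_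
    simpa [K'.tapeIndex] using hS.pop .main (parse (w ++ [a]))

/-- Induction on the number `n` of tapes still to be read in round `t`: the heads of tapes below `j`
have already moved to `t + 1`, the others are still at `t`. -/
theorem reach_readFrom (S : K' → List Γ') (t : ℕ) (n : ℕ) (j : ℕ) (hj : j + n = k)
    (r : Fin k → Fin (A + 1)) (hr : ∀ i : Fin k, i < j → r i = e (p i t))
    (d : FreeConfig σ k 4 (Option Γ') (LoopState k A)) (hd : d.state = readFrom code j r)
    (hS : Stores S d) (hp : ∀ i : Fin k, d.inPos i = if i < j then t + 1 else t) :
    ∃ d', FreeReach (instr e code dec B) p d d' ∧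
      d'.state = start (code fun i => e (p i t)) ∧ Stores S d' ∧ (d'.inPos = fun _ => t + 1) ∧
      d'.output = d.output := by
  induction n generalizing j r d with
  | zero =>
    refine ⟨d, .refl, ?_, hS, ?_, rfl⟩
    · rw [hd, readFrom, dif_neg (by omega)]
      congr
      funext i
      exact hr i (by omega)
    · funext i
      rw [hp, if_pos (by omega)]
  | succ n ih =>
    have hjk : j < k := by omega
    rw [readFrom, dif_pos hjk] at hd
    have hpj : d.inPos ⟨j, hjk⟩ = t := by rw [hp]; simp
    obtain ⟨d', h1, h2, h3, h4, h5⟩ := ih (j + 1) (by omega)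
      (Function.update r ⟨j, hjk⟩ (e (p ⟨j, hjk⟩ t))) (by
        intro i hi
        by_cases hij : i = ⟨j, hjk⟩
        · subst hij; simp
        · rw [Function.update_of_ne hij]
          exact hr i (by have : i.1 ≠ j := fun h => hij (Fin.ext h); omega))
      { d with
        state := readFrom code (j + 1) (Function.update r ⟨j, hjk⟩ (e (p ⟨j, hjk⟩ t)))
        inPos := Function.update d.inPos ⟨j, hjk⟩ (t + 1) } rfl hS (by
        intro i
        by_cases hij : i = ⟨j, hjk⟩
        · subst hij; simp
        · have : i.1 ≠ j := fun h => hij (Fin.ext h)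
          simp only [Function.update_of_ne hij, hp]
          split_ifs <;> first | rfl | omega)
    refine ⟨d', .head (b := ⟨move ⟨j, hjk⟩ (Function.update r ⟨j, hjk⟩ (e (p ⟨j, hjk⟩ t))),
      d.inPos, d.tape, d.head, d.output⟩) ?_ (.head ?_ h1), h2, h3, h4, h5⟩
    · simp only [freeStep, hd, instr, hpj]
    · simp only [freeStep, instr, hpj]

end LoopState

end CodeLoop

/-! ### Finiteness of the reachable states, and the loop machine -/

section CodeLoop

open Turing Turing.PartrecToTM2

namespace LoopState

variable {σ : Type s} {k A : ℕ}

/-- The states reachable if the labels of the stack machine are taken from `F`. -/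
def Allowed (F : Finset Λ') (B : ℕ) : LoopState k A → Prop
  | run q _ => ∃ l ∈ F, q ∈ TM2.stmts₁ (tr l)
  | push _ _ q _ => ∃ l ∈ F, q ∈ TM2.stmts₁ (tr l)
  | pop _ q _ => ∃ l ∈ F, q ∈ TM2.stmts₁ (tr l)
  | parse w => w.length ≤ B
  | parsed w _ => w.length ≤ B
  | _ => True

/-- The type of statements is infinite, but the finitely many labels in `F` have only finitely many
substatements, and the collected words have length at most `B` over a finite alphabet. -/
theorem finite_allowed (F : Finset Λ') (B : ℕ) :
    {x : LoopState k A | Allowed F B x}.Finite := by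
  classical
  let T := {q : CodeStmt // q ∈ F.biUnion fun l => TM2.stmts₁ (tr l)}
  let W := {w : List Γ' // w.length ≤ B}
  have hW : Finite W := (List.finite_length_le Γ' B).to_subtype
  have hK : Finite K' := Finite.of_injective _ K'.tapeIndex_injective
  refine ((((((((Set.finite_range fun x : T × Option Γ' => run x.1.1 x.2).union
    (Set.finite_range fun x : Γ' × K' × T × Option Γ' => push x.1 x.2.1 x.2.2.1.1 x.2.2.2)).union
    (Set.finite_range fun x : K' × T × Option Γ' => pop x.1 x.2.1.1 x.2.2)).union
    (Set.finite_range fun x : W => parse x.1)).union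
    (Set.finite_range fun x : W × Γ' => parsed x.1.1 x.2)).union
    (Set.finite_range emit)).union
    (Set.finite_range fun x : Fin k × (Fin k → Fin (A + 1)) => read x.1 x.2)).union
    (Set.finite_range fun x : Fin k × (Fin k → Fin (A + 1)) => move x.1 x.2)).subset ?_
  have hT : ∀ q : CodeStmt, (∃ l ∈ F, q ∈ TM2.stmts₁ (tr l)) → ∃ x : T, x.1 = q :=
    fun q hq => ⟨⟨q, by simpa using hq⟩, rfl⟩
  intro x hx
  cases x <;> simp only [Set.mem_ofPred_eq, Allowed] at hx <;> simp only [Set.mem_union, Set.mem_range]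
  case run q v =>
    obtain ⟨y, rfl⟩ := hT q hx
    iterate 7 left
    exact ⟨(y, v), rfl⟩
  case push a κ q v =>
    obtain ⟨y, rfl⟩ := hT q hx
    iterate 6 left
    exact .inr ⟨(a, κ, y, v), rfl⟩
  case pop κ q v =>
    obtain ⟨y, rfl⟩ := hT q hx
    iterate 5 left
    exact .inr ⟨(κ, y, v), rfl⟩
  case parse w =>
    iterate 4 left
    exact .inr ⟨⟨w, hx⟩, rfl⟩
  case parsed w a =>
    iterate 3 left
    exact .inr ⟨(⟨w, hx⟩, a), rfl⟩
  case emit i => exact .inl (.inl (.inr ⟨i, rfl⟩))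
  case read j r => exact .inl (.inr ⟨(j, r), rfl⟩)
  case move j r => exact .inr ⟨(j, r), rfl⟩

theorem allowed_start {F : Finset Λ'} {B : ℕ} {c : ToPartrec.Code}
    (h : codeSupp c Cont'.halt ⊆ F) : Allowed F B (start c : LoopState k A) :=
  ⟨_, h (codeSupp_self _ _ (trStmts₁_self _)), TM2.stmts₁_self⟩

theorem allowed_readFrom {F : Finset Λ'} {B : ℕ} {code : (Fin k → Fin (A + 1)) → ToPartrec.Code}
    (hF : ∀ r, codeSupp (code r) Cont'.halt ⊆ F) (j : ℕ) (r : Fin k → Fin (A + 1)) :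
    Allowed F B (readFrom code j r) := by
  unfold readFrom
  split_ifs
  · trivial
  · exact allowed_start (hF r)

/-- Apart from `goto`, a statement leads only to its own substatements; a `goto` stays among the
labels in `F` because `F` supports the statements of its labels. -/
theorem allowed_targets {F : Finset Λ'} {B : ℕ} {code : (Fin k → Fin (A + 1)) → ToPartrec.Code}
    {e : σ ≃ Fin (A + 1)} {dec : List Γ' → Option (Fin (A + 1))}
    (hF : ∀ r, codeSupp (code r) Cont'.halt ⊆ F)
    (hs : ∀ l ∈ F, TM2.SupportsStmt F (tr l)) (x : LoopState k A) (hx : Allowed F B x)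
    (y : LoopState k A) (hy : y ∈ (instr e code dec B x).targets) : Allowed F B y := by
  have hsub : ∀ {q q' : CodeStmt}, q ∈ TM2.stmts₁ q' → (∃ l ∈ F, q' ∈ TM2.stmts₁ (tr l)) →
      ∃ l ∈ F, q ∈ TM2.stmts₁ (tr l) :=
    fun h ⟨l, hl, h'⟩ => ⟨l, hl, TM2.stmts₁_trans h' h⟩
  have hself : ∀ {q : CodeStmt}, q ∈ TM2.stmts₁ q := TM2.stmts₁_self
  cases x with
  | run q v =>
    cases q with
    | push κ f q =>
      obtain rfl := hy
      exact hsub (by simp [TM2.stmts₁, hself]) hx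
    | peek κ f q =>
      obtain ⟨a, rfl⟩ := hy
      exact hsub (q := q) (by simp [TM2.stmts₁, hself]) hx
    | pop κ f q =>
      obtain ⟨a, rfl⟩ := hy
      cases a <;> exact hsub (q := q) (by simp [TM2.stmts₁, hself]) hx
    | load f q =>
      obtain ⟨a, rfl⟩ := hy
      exact hsub (q := q) (by simp [TM2.stmts₁, hself]) hx
    | branch f q₁ q₂ =>
      obtain ⟨a, rfl⟩ := hy
      show Allowed F B (cond (f v) (run q₁ v) (run q₂ v))
      cases f v
      · exact hsub (q := q₂) (by simp [TM2.stmts₁, hself]) hx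
      · exact hsub (q := q₁) (by simp [TM2.stmts₁, hself]) hx
    | goto f =>
      obtain ⟨a, rfl⟩ := hy
      obtain ⟨l, hl, h⟩ := hx
      exact ⟨f v, TM2.stmts₁_supportsStmt_mono h (hs l hl) v, hself⟩
    | halt =>
      obtain ⟨a, rfl⟩ := hy
      exact Nat.zero_le _
  | push a κ q v =>
    obtain rfl := hy
    exact hx
  | pop κ q v =>
    obtain rfl := hy
    exact hx
  | parse w =>
    obtain ⟨a, rfl⟩ := hy
    cases a <;> exact hx
  | parsed w a =>
    obtain rfl := hy
    show Allowed F B (if a = Γ'.cons then afterParse code dec w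
      else if w.length < B then parse (w ++ [a]) else parse w)
    split_ifs with h1 h2
    · unfold afterParse
      split
      · trivial
      · exact allowed_readFrom hF _ _
    · show (w ++ [a]).length ≤ B
      simpa using h2
    · exact hx
  | emit i =>
    obtain rfl := hy
    exact allowed_readFrom hF _ _
  | read j r =>
    obtain ⟨a, rfl⟩ := hy
    trivial
  | move j r =>
    obtain rfl := hy
    exact allowed_readFrom hF _ _

end LoopState

theorem trPosNum_injective : Function.Injective trPosNum := by
  -- The numerals `one` and `bit1 b` begin with the same digit; only the non-emptiness of the rest
  -- separates them.
  have hnil : ∀ a, trPosNum a ≠ [] := fun a => by cases a <;> simp [trPosNum]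
  intro a
  induction a with
  | one =>
    intro b h
    cases b with
    | one => rfl
    | bit0 b => simp [trPosNum] at h
    | bit1 b => simp [trPosNum, (hnil b).symm] at h
  | bit0 a ih =>
    intro b h
    cases b with
    | one => simp [trPosNum] at h
    | bit0 b => rw [ih (List.cons.inj h).2]
    | bit1 b => simp [trPosNum] at h
  | bit1 a ih =>
    intro b h
    cases b with
    | one => simp [trPosNum, hnil a] at h
    | bit0 b => simp [trPosNum] at h
    | bit1 b => rw [ih (List.cons.inj h).2]

/-- The finite control sees a number only as a word of digits, so decoding an output symbol requires
that the word determine the number. -/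
theorem trNat_injective : Function.Injective trNat := by
  intro a b h
  have : ((a : ℕ) : Num) = b := by
    revert h
    unfold trNat
    generalize (a : Num) = a
    generalize (b : Num) = b
    intro h
    cases a with
    | zero =>
      cases b with
      | zero => rfl
      | pos b => cases b <;> simp [trNum, trPosNum] at h
    | pos a =>
      cases b with
      | zero => cases a <;> simp [trNum, trPosNum] at h
      | pos b => rw [trPosNum_injective h]
  exact_mod_cast congrArg (fun n : Num => (n : ℕ)) this

theorem cons_notMem_trNat (n : ℕ) : Γ'.cons ∉ trNat n := fun h => by
  simpa using trNat_natEnd n _ h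

theorem exists_code_of_primrec {f : ℕ → ℕ} (hf : Primrec f) :
    ∃ c : ToPartrec.Code, ∀ n, c.eval [n] = pure [f n] := by
  obtain ⟨c, hc⟩ := ToPartrec.Code.exists_code
    ((Nat.Partrec'.part_iff₁ (f := fun n => Part.some (f n))).2 hf.to_comp)
  refine ⟨c, fun n => ?_⟩
  refine (hc (n ::ᵥ List.Vector.nil)).trans ?_
  simp

/-- The output symbol and the state of a loop with the rules `out` and `next` in round `t`, where
`r t` is the tuple of the symbols read in this round. -/
def loopTrace {R O : Type*} (out : R → ℕ → Option O) (next : R → ℕ → ℕ) (r : ℕ → R) :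
    ℕ → Option O × ℕ
  | 0 => (none, 0)
  | t + 1 => (out (r t) (loopTrace out next r t).2, next (r t) (loopTrace out next r t).2)

/-- The word written by a loop before round `t`. -/
def loopWritten {R O : Type*} (out : R → ℕ → Option O) (next : R → ℕ → ℕ) (r : ℕ → R) :
    ℕ → List O
  | 0 => []
  | t + 1 => loopWritten out next r t ++ (loopTrace out next r t).1.toList

open LoopState in
/-- A loop with primitive recursive rules can be executed by a Type-2 machine. -/
theorem exists_type2Machine_loop {σ : Type s} {k A : ℕ} (e : σ ≃ Fin (A + 1))
    (out : (Fin k → Fin (A + 1)) → ℕ → Option (Fin (A + 1)))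
    (next : (Fin k → Fin (A + 1)) → ℕ → ℕ) (hout : ∀ r, Primrec (out r))
    (hnext : ∀ r, Primrec (next r)) :
    ∃ M : Type2Machine σ k, ∀ p q,
      (∀ i, ∃ t, (loopWritten out next (fun t j => e (p j t)) t)[i]? = some (e (q i))) →
      M.YieldsSeq p q := by
  classical
  have h1 : ∀ r, ∃ c : ToPartrec.Code, ∀ n,
      c.eval [n] = pure [Encodable.encode (out r n), next r n] := by
    intro r
    obtain ⟨c₁, h₁⟩ := exists_code_of_primrec (Primrec.encode.comp (hout r))
    obtain ⟨c₂, h₂⟩ := exists_code_of_primrec (hnext r)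
    refine ⟨c₁.cons c₂, fun n => ?_⟩
    simp [ToPartrec.Code.cons_eval, h₁, h₂]
  choose code hcode using h1
  -- The list `[0, 0]` encodes the pair `(none, 0)` with which `loopTrace` begins. Producing it by a
  -- code lets round `0` start like all the others.
  let code₀ : ToPartrec.Code := .comp .zero' .zero'
  have hcode₀ : [0, 0] ∈ code₀.eval [] := by simp [code₀]
  let F : Finset Λ' := (Finset.univ.biUnion fun r => codeSupp (code r) Cont'.halt) ∪
    codeSupp code₀ Cont'.halt
  have hF : ∀ r, codeSupp (code r) Cont'.halt ⊆ F := fun r =>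
    (Finset.subset_biUnion_of_mem (fun r => codeSupp (code r) Cont'.halt)
      (Finset.mem_univ r)).trans Finset.subset_union_left
  have hF₀ : codeSupp code₀ Cont'.halt ⊆ F := Finset.subset_union_right
  have hs : ∀ l ∈ F, TM2.SupportsStmt F (tr l) := by
    intro l hl
    rcases Finset.mem_union.1 hl with hl | hl
    · obtain ⟨r, -, hr⟩ := Finset.mem_biUnion.1 hl
      exact codeSupp_supports (hF r) l hr
    · exact codeSupp_supports hF₀ l hl
  let word : Option (Fin (A + 1)) → List Γ' := fun o => trNat (Encodable.encode o)
  have hword : Function.Injective word := trNat_injective.comp Encodable.encode_injective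
  let dec : List Γ' → Option (Fin (A + 1)) := Function.invFun word
  have hdec : ∀ o, dec (word o) = o := Function.leftInverse_invFun hword
  -- There are finitely many possible outputs, so their digit words have a common bound on the
  -- length.
  let B : ℕ := Finset.univ.sup fun o => (word o).length
  have hB : ∀ o, (word o).length ≤ B := fun o =>
    Finset.le_sup (f := fun o => (word o).length) (Finset.mem_univ o)
  have hstart : Allowed F B (start code₀ : LoopState k A) := allowed_start hF₀
  refine ⟨restrictProgram (instr e code dec B) none {x | Allowed F B x} (finite_allowed F B)
    ⟨start code₀, hstart⟩, fun p q hq => ?_⟩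
  set r : ℕ → Fin k → Fin (A + 1) := fun t j => e (p j t) with hr
  -- A round begins when an evaluation has ended. The symbol that it selected is still on the main
  -- stack, which is why the word written so far is `loopWritten` at `t`, without the symbol of
  -- `loopTrace` at `t`.
  refine restrictProgram_yieldsSeq
    (fun x hx y hy => allowed_targets hF hs x hx y hy)
    (fun t d => d.state = parse [] ∧
      Stores (K'.elim (trList [Encodable.encode (loopTrace out next r t).1,
        (loopTrace out next r t).2]) [] [] []) d ∧
      (d.inPos = fun _ => t) ∧ d.output = (loopWritten out next r t).map e.symm) ?_ ?_ ?_
  · obtain ⟨d, h2, h3, h4, h5, h6⟩ := leads_eval (e := e) (code := code) (dec := dec) (B := B)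
      (p := p) hcode₀ ⟨start code₀, fun _ => 0, fun _ _ => none, fun _ => 0, []⟩ rfl
      (by intro κ i; cases κ <;> simp)
    exact ⟨d, h2, h3, by simpa [loopTrace] using h4, h5, h6⟩
  · rintro t d ⟨h2, h3, h4, h5⟩
    have h6 := cons_notMem_trNat (Encodable.encode (loopTrace out next r t).1)
    obtain ⟨d₁, h7, h8, h9, h10, h11⟩ := leads_parse (e := e) (code := code) (dec := dec) (B := B)
      (p := p) [] (word (loopTrace out next r t).1)
      (trList [(loopTrace out next r t).2]) h6 (by simpa using hB _) d h2 h3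
    have h12 : ∃ d₂, FreeReach (instr e code dec B) p d₁ d₂ ∧
        d₂.state = readFrom code 0 (fun _ => 0) ∧
        Stores (K'.elim (trList [(loopTrace out next r t).2]) [] [] []) d₂ ∧
        d₂.inPos = d₁.inPos ∧
        d₂.output = (loopWritten out next r (t + 1)).map e.symm := by
      rw [List.nil_append, afterParse, hdec] at h8
      rw [loopWritten, List.map_append, ← h5, ← h11]
      cases ho : (loopTrace out next r t).1 with
      | none => simp only [ho] at h8; exact ⟨d₁, .refl, h8, h9, rfl, by simp⟩
      | some i =>
        simp only [ho] at h8
        refine ⟨⟨readFrom code 0 fun _ => 0, d₁.inPos, d₁.tape, d₁.head,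
          d₁.output ++ [e.symm i]⟩, .single ?_, rfl, h9, rfl, by simp⟩
        simp only [freeStep, h8, instr]
    obtain ⟨d₂, h13, h14, h15, h16, h17⟩ := h12
    obtain ⟨d₃, h18, h19, h20, h21, h22⟩ := reach_readFrom (e := e) (code := code) (dec := dec)
      (B := B) (p := p) _ t k 0 (by simp) (fun _ => 0) (by simp) d₂ h14 h15
      (by intro i; simp [h16, h10, h4])
    obtain ⟨d₄, h23, h24, h25, h26, h27⟩ := leads_eval (e := e) (code := code) (dec := dec)
      (B := B) (p := p) (c := code (r t)) (v := [(loopTrace out next r t).2])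
      (v' := [Encodable.encode (loopTrace out next r (t + 1)).1, (loopTrace out next r (t + 1)).2])
      (by rw [hcode]; exact Part.mem_some _) d₃ h19 h20
    -- Parsing takes at least one step: otherwise the state after parsing would be `parse []`, but
    -- it is an `emit`, `read` or `run` state.
    rcases h7.cases_head with rfl | ⟨d', h28, h29⟩
    · exfalso
      rw [h2] at h8
      unfold afterParse readFrom at h8
      split at h8
      · cases h8
      · split_ifs at h8
        all_goals cases h8
    · exact ⟨d', d₄, h28, h29.trans (h13.trans (h18.trans h23)), h24, h25, h26.trans h21,
        h27.trans (h22.trans h17)⟩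
  · intro i
    obtain ⟨t, ht⟩ := hq i
    refine ⟨t, fun d hd => ?_⟩
    rw [hd.2.2.2, List.getElem?_map, ht]
    simp

end CodeLoop

/-! ### Approximation of functions on sequences by functions on words -/

section Approximation

variable {σ : Type s} {n : ℕ}

/-- The word `w` is a prefix of the sequence `q`. -/
def SeqPrefix (w : List σ) (q : ℕ → σ) : Prop :=
  ∀ i a, w[i]? = some a → q i = a

/-- On prefixes of `p` the function `h` yields prefixes of every `q ∈ g p`, and these become
arbitrarily long with increasing precision. -/
def ApproximatesSeq (h : ℕ → (Fin n → List σ) → List σ)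
    (g : MultiFun (Fin n → ℕ → σ) (ℕ → σ)) : Prop :=
  ∀ p, ∀ q ∈ g p,
    (∀ t u, (∀ j, SeqPrefix (u j) (p j)) → SeqPrefix (h t u) q) ∧
    ∀ N, ∃ t₀, ∀ t ≥ t₀, ∀ u, (∀ j, SeqPrefix (u j) (p j) ∧ t₀ ≤ (u j).length) →
      N ≤ (h t u).length

/-- On prefixes of `p` the function `h` yields no word except `w ∈ g p`, and `w` with sufficient
precision. -/
def ApproximatesWord (h : ℕ → (Fin n → List σ) → Option (List σ))
    (g : MultiFun (Fin n → ℕ → σ) (List σ)) : Prop :=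
  ∀ p, ∀ w ∈ g p,
    (∀ t u, (∀ j, SeqPrefix (u j) (p j)) → ∀ w' ∈ h t u, w' = w) ∧
    ∃ t₀, ∀ t ≥ t₀, ∀ u, (∀ j, SeqPrefix (u j) (p j) ∧ t₀ ≤ (u j).length) → h t u = some w

theorem seqPrefix_map_range (q : ℕ → σ) (t : ℕ) : SeqPrefix ((List.range t).map q) q := by
  intro i a h
  simp only [List.getElem?_map, Option.map_eq_some_iff] at h
  obtain ⟨j, hj, rfl⟩ := h
  rw [List.getElem?_range (by by_contra hi; simp [List.getElem?_eq_none (l := List.range t)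
    (by simpa using hi)] at hj)] at hj
  cases hj
  rfl

theorem SeqPrefix.eq_of_lt {w : List σ} {q q' : ℕ → σ} (h : SeqPrefix w q) (h' : SeqPrefix w q')
    {i : ℕ} (hi : i < w.length) : q i = q' i :=
  (h i w[i] (List.getElem?_eq_getElem hi)).trans (h' i w[i] (List.getElem?_eq_getElem hi)).symm

/-- In the Cantor topology every neighbourhood contains a set of sequences with common prefixes. -/
theorem exists_agree_subset {g : Set (Fin n → ℕ → σ)} {U : Set g}
    (hU : letI : TopologicalSpace σ := ⊥; IsOpen U) {p : g} (hp : p ∈ U) :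
    ∃ M, ∀ p' : g, (∀ j, ∀ i < M, p'.1 j i = p.1 j i) → p' ∈ U := by
  let _ : TopologicalSpace σ := ⊥
  obtain ⟨V, hV, rfl⟩ := isOpen_induced_iff.1 hU
  obtain ⟨I, u, hu, hsub⟩ := isOpen_pi_iff.1 hV p.1 hp
  have h1 : ∀ j, ∃ M, ∀ q : ℕ → σ, (∀ i < M, q i = p.1 j i) → j ∈ I → q ∈ u j := by
    intro j
    by_cases hj : j ∈ I
    · obtain ⟨J, v, hv, hsub'⟩ := isOpen_pi_iff.1 (hu j hj).1 (p.1 j) (hu j hj).2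
      refine ⟨J.sup id + 1, fun q hq _ => hsub' fun i hi => ?_⟩
      rw [hq i (Nat.lt_succ_of_le (Finset.le_sup (f := id) hi))]
      exact (hv i hi).2
    · exact ⟨0, fun _ _ h => absurd h hj⟩
  choose M hM using h1
  refine ⟨Finset.univ.sup M, fun p' hp' => hsub fun j hj => hM j _ (fun i hi => hp' j i ?_) hj⟩
  exact hi.trans_le (Finset.le_sup (Finset.mem_univ j))

/-- A continuous function on sequences is approximated by a function on words. -/
theorem ContinuousToSeq.exists_approximates {g : (Fin n → ℕ → σ) →. (ℕ → σ)}
    (hg : ContinuousToSeq g) : ∃ h, ApproximatesSeq h g.toMultiFun := by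
  classical
  let Ext : (Fin n → List σ) → g.Dom → Prop := fun u p => ∀ j, SeqPrefix (u j) (p.1 j)
  let Agree : (Fin n → List σ) → ℕ → Prop := fun u N =>
    ∀ p p' : g.Dom, Ext u p → Ext u p' → ∀ i < N, g.asSubtype p i = g.asSubtype p' i
  -- The longest word, of length at most `t`, that is a prefix of all values of `g` at extensions of
  -- `u`. The bound `t` keeps it finite even if `u` determines the whole value. Continuity makes it
  -- long for long prefixes.
  let h : ℕ → (Fin n → List σ) → List σ := fun t u =>
    if hp : ∃ p : g.Dom, Ext u p then
      (List.range (Nat.findGreatest (Agree u) t)).map (g.asSubtype hp.choose)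
    else []
  refine ⟨h, fun p q hq => ?_⟩
  obtain ⟨hd, hq⟩ := hq
  have hpq : g.asSubtype ⟨p, hd⟩ = q := hq
  refine ⟨fun t u hu => ?_, fun N => ?_⟩
  · have hp : ∃ p : g.Dom, Ext u p := ⟨⟨p, hd⟩, hu⟩
    have hA : Agree u (Nat.findGreatest (Agree u) t) :=
      Nat.findGreatest_spec (Nat.zero_le t) (fun _ _ _ _ i hi => absurd hi (Nat.not_lt_zero i))
    simp only [h, dif_pos hp]
    intro i a ha
    rw [← seqPrefix_map_range _ _ i a ha, ← hpq]
    refine hA _ _ hu hp.choose_spec i ?_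
    by_contra hi
    simp [not_lt.1 hi] at ha
  · have hopen : letI : TopologicalSpace σ := ⊥
        IsOpen {p' : g.Dom | ∀ i ∈ Set.Iio N, g.asSubtype p' i = q i} := by
      let _ : TopologicalSpace σ := ⊥
      have : DiscreteTopology σ := ⟨rfl⟩
      have hg' : Continuous g.asSubtype := hg
      have : {p' : g.Dom | ∀ i ∈ Set.Iio N, g.asSubtype p' i = q i} =
          ⋂ i ∈ Set.Iio N, (fun p' : g.Dom => g.asSubtype p' i) ⁻¹' {q i} := by
        ext p'
        simp
      rw [this]
      exact (Set.finite_Iio N).isOpen_biInter fun i _ =>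
        (isOpen_discrete _).preimage ((continuous_apply i).comp hg')
    obtain ⟨M, hM⟩ := exists_agree_subset hopen (p := ⟨p, hd⟩) (fun i _ => by rw [hpq])
    refine ⟨max M N, fun t ht u hu => ?_⟩
    have hp : ∃ p : g.Dom, Ext u p := ⟨⟨p, hd⟩, fun j => (hu j).1⟩
    have key : ∀ p' : g.Dom, Ext u p' → ∀ i < N, g.asSubtype p' i = q i := by
      intro p' hp' i hi
      refine hM p' (fun j i hi => ?_) i hi
      exact (hp' j).eq_of_lt (hu j).1 (hi.trans_le ((le_max_left _ _).trans (hu j).2))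
    simp only [h, dif_pos hp, List.length_map, List.length_range]
    exact Nat.le_findGreatest ((le_max_right _ _).trans ht)
      fun p₁ p₂ h₁ h₂ i hi => (key p₁ h₁ i hi).trans (key p₂ h₂ i hi).symm

/-- A continuous function from sequences to words is approximated by a function on words. -/
theorem ContinuousToWord.exists_approximates {g : (Fin n → ℕ → σ) →. List σ}
    (hg : ContinuousToWord g) : ∃ h, ApproximatesWord h g.toMultiFun := by
  classical
  let Ext : (Fin n → List σ) → g.Dom → Prop := fun u p => ∀ j, SeqPrefix (u j) (p.1 j)
  -- The common value of `g` at all extensions of `u`, if there is one. When no extension lies in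
  -- the domain the choice is arbitrary; this is harmless, since only prefixes of points of the
  -- domain matter.
  let h : ℕ → (Fin n → List σ) → Option (List σ) := fun _ u =>
    if hw : ∃ w, ∀ p : g.Dom, Ext u p → g.asSubtype p = w then some hw.choose else none
  refine ⟨h, fun p w hw => ?_⟩
  obtain ⟨hd, hw⟩ := hw
  have hpw : g.asSubtype ⟨p, hd⟩ = w := hw
  have hsound : ∀ t u, (∀ j, SeqPrefix (u j) (p j)) → ∀ w' ∈ h t u, w' = w := by
    intro t u hu w' hw'
    simp only [h] at hw'
    split_ifs at hw' with hex
    · cases hw'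
      exact (hex.choose_spec ⟨p, hd⟩ hu).symm.trans hpw
    · cases hw'
  refine ⟨hsound, ?_⟩
  have hopen : letI : TopologicalSpace σ := ⊥
      IsOpen {p' : g.Dom | g.asSubtype p' = w} := by
    let _ : TopologicalSpace σ := ⊥
    let _ : TopologicalSpace (List σ) := ⊥
    have : DiscreteTopology (List σ) := ⟨rfl⟩
    have hg' : Continuous g.asSubtype := hg
    exact (isOpen_discrete {w}).preimage hg'
  obtain ⟨M, hM⟩ := exists_agree_subset hopen (p := ⟨p, hd⟩) hpw
  refine ⟨M, fun t _ u hu => ?_⟩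
  have hex : ∃ w, ∀ p : g.Dom, Ext u p → g.asSubtype p = w := ⟨w, fun p' hp' =>
    hM p' fun j i hi => (hp' j).eq_of_lt (hu j).1 (hi.trans_le (hu j).2)⟩
  have h1 : h t u = some hex.choose := dif_pos hex
  rw [h1, hsound t u (fun j => (hu j).1) _ h1]

/-- A function that is approximated by a function on words is continuous. -/
theorem ApproximatesSeq.continuousToSeq {g : (Fin n → ℕ → σ) →. (ℕ → σ)}
    {h : ℕ → (Fin n → List σ) → List σ} (hg : ApproximatesSeq h g.toMultiFun) :
    ContinuousToSeq g := by
  let _ : TopologicalSpace σ := ⊥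
  have : DiscreteTopology σ := ⟨rfl⟩
  show Continuous g.asSubtype
  have hmem : ∀ p : g.Dom, g.asSubtype p ∈ g.toMultiFun p.1 := fun p => ⟨p.2, rfl⟩
  refine continuous_pi fun i => continuous_iff_continuousAt.2 fun p => ?_
  obtain ⟨hs, hc⟩ := hg p.1 _ (hmem p)
  -- At precision `t₀` the prefixes of length `t₀` already yield `i + 1` symbols. Every point of the
  -- domain with the same prefixes has a value with the same approximating word, hence the same
  -- symbol at `i`.
  obtain ⟨t₀, ht₀⟩ := hc (i + 1)
  let u : Fin n → List σ := fun j => (List.range t₀).map (p.1 j)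
  have hu : ∀ j, SeqPrefix (u j) (p.1 j) := fun j => seqPrefix_map_range _ _
  have hlen := ht₀ t₀ le_rfl u fun j => ⟨hu j, by simp [u]⟩
  refine ContinuousAt.congr (f := fun _ => g.asSubtype p i) continuousAt_const ?_
  have hnhds : {p' : g.Dom | ∀ j, ∀ i ∈ Set.Iio t₀, p'.1 j i = p.1 j i} ∈ nhds p := by
    have : {p' : g.Dom | ∀ j, ∀ i ∈ Set.Iio t₀, p'.1 j i = p.1 j i} =
        ⋂ j, ⋂ i ∈ Set.Iio t₀, (fun p' : g.Dom => p'.1 j i) ⁻¹' {p.1 j i} := by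
      ext p'
      simp
    refine IsOpen.mem_nhds ?_ (by simp)
    rw [this]
    exact isOpen_iInter_of_finite fun j => (Set.finite_Iio t₀).isOpen_biInter fun i _ =>
      (isOpen_discrete _).preimage
        ((continuous_apply i).comp ((continuous_apply j).comp continuous_subtype_val))
  filter_upwards [hnhds] with p' hp'
  refine (hs t₀ u hu).eq_of_lt ((hg p'.1 _ (hmem p')).1 t₀ u fun j => ?_) (Nat.lt_of_succ_le hlen)
  intro i' a ha
  have hi' : i' < t₀ := by
    by_contra hi'
    simp [u, not_lt.1 hi'] at ha
  rw [hp' j i' hi']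
  exact hu j i' a ha

end Approximation

/-! ### From primitive recursive approximations to Type-2 machines -/

section OfApproximation

/-- The code of `a`, which is positive. -/
def encodeSucc {α : Type*} [Primcodable α] (a : α) : ℕ := Encodable.encode a + 1

/-- Decode `n`, with value `d` if `n` is `0` or not a code. -/
def decodeSucc {α : Type*} [Primcodable α] (d : α) (n : ℕ) : α :=
  n.casesOn d fun m => (Encodable.decode m).getD d

theorem decodeSucc_encodeSucc {α : Type*} [Primcodable α] (d a : α) :
    decodeSucc d (encodeSucc a) = a := by
  simp [decodeSucc, encodeSucc]

theorem primrec_encodeSucc {α : Type*} [Primcodable α] : Primrec (encodeSucc : α → ℕ) :=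
  Primrec.succ.comp Primrec.encode

theorem primrec_decodeSucc {α : Type*} [Primcodable α] (d : α) : Primrec (decodeSucc d) :=
  Primrec.nat_casesOn Primrec.id (Primrec.const d)
    ((Primrec.option_getD.comp Primrec.decode (Primrec.const d)).comp₂ Primrec₂.right)

variable {σ : Type s} [Primcodable σ] {k A : ℕ}

/-- The data of the loop that writes the limit of an approximation: the precision, the number of
symbols already written, and the symbols already read. -/
abbrev LimitState (σ : Type s) (k : ℕ) := ℕ × ℕ × (Fin k → List σ)

/-- The words read, extended by one symbol each. -/
def extendWords (e : σ ≃ Fin (A + 1)) (r : Fin k → Fin (A + 1)) (u : Fin k → List σ) :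
    Fin k → List σ :=
  fun j => u j ++ [e.symm (r j)]

/-- Decode the data of the loop. -/
def limitState (n : ℕ) : LimitState σ k :=
  decodeSucc (0, 0, fun _ => []) n

/-- The symbol written in a round of the loop. -/
def limitOut (e : σ ≃ Fin (A + 1)) (H : ℕ → (Fin k → List σ) → List σ)
    (r : Fin k → Fin (A + 1)) (s : LimitState σ k) : Option (Fin (A + 1)) :=
  ((H (s.1 + 1) (extendWords e r s.2.2))[s.2.1]?).map e

/-- The data after a round of the loop. -/
def limitNext (e : σ ≃ Fin (A + 1)) (H : ℕ → (Fin k → List σ) → List σ)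
    (r : Fin k → Fin (A + 1)) (s : LimitState σ k) : LimitState σ k :=
  (s.1 + 1, s.2.1 + (limitOut e H r s).toList.length, extendWords e r s.2.2)

theorem primrec_limitState : Primrec (limitState : ℕ → LimitState σ k) :=
  primrec_decodeSucc _

theorem primrec_extendWords (e : σ ≃ Fin (A + 1)) (r : Fin k → Fin (A + 1)) :
    Primrec (extendWords e r) := by
  refine Primrec.fin_curry.2 ?_
  exact Primrec.list_append.comp (Primrec.fin_app.comp Primrec.fst Primrec.snd)
    ((Primrec.dom_finite fun j => [e.symm (r j)]).comp Primrec.snd)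

variable [Finite σ]

theorem primrec_limitOut (e : σ ≃ Fin (A + 1)) {H : ℕ → (Fin k → List σ) → List σ}
    (hH : Primrec₂ H) (r : Fin k → Fin (A + 1)) : Primrec (limitOut e H r) := by
  refine Primrec.option_map (Primrec.list_getElem?.comp (hH.comp
    (Primrec.succ.comp Primrec.fst)
    ((primrec_extendWords e r).comp (Primrec.snd.comp Primrec.snd)))
    (Primrec.fst.comp Primrec.snd)) ?_
  exact (Primrec.dom_finite e).comp₂ Primrec₂.right

theorem primrec_limitNext (e : σ ≃ Fin (A + 1)) {H : ℕ → (Fin k → List σ) → List σ}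
    (hH : Primrec₂ H) (r : Fin k → Fin (A + 1)) : Primrec (limitNext e H r) := by
  refine Primrec.pair (Primrec.succ.comp Primrec.fst) (Primrec.pair ?_
    ((primrec_extendWords e r).comp (Primrec.snd.comp Primrec.snd)))
  exact Primrec.nat_add.comp (Primrec.fst.comp Primrec.snd)
    (Primrec.list_length.comp (Primrec.optionToList.comp (primrec_limitOut e hH r)))

/-- A function that is approximated by a primitive recursive function on words is computable. -/
theorem ApproximatesSeq.computableToSeq [Nonempty σ] {g : (Fin k → ℕ → σ) →. (ℕ → σ)}
    {H : ℕ → (Fin k → List σ) → List σ} (hH : Primrec₂ H) (hg : ApproximatesSeq H g.toMultiFun) :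
    ComputableToSeq g := by
  obtain ⟨A, ⟨e⟩⟩ : ∃ A, Nonempty (σ ≃ Fin (A + 1)) := by
    refine ⟨Nat.card σ - 1, ⟨(Finite.equivFin σ).trans (finCongr ?_)⟩⟩
    have := Nat.card_pos (α := σ)
    omega
  let out : (Fin k → Fin (A + 1)) → ℕ → Option (Fin (A + 1)) :=
    fun r n => limitOut e H r (limitState n)
  let next : (Fin k → Fin (A + 1)) → ℕ → ℕ :=
    fun r n => encodeSucc (limitNext e H r (limitState n))
  obtain ⟨M, hM⟩ := exists_type2Machine_loop e out next
    (fun r => (primrec_limitOut e hH r).comp primrec_limitState)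
    (fun r => primrec_encodeSucc.comp ((primrec_limitNext e hH r).comp primrec_limitState))
  refine ⟨M, fun p q hq => hM p q ?_⟩
  obtain ⟨hs, hc⟩ := hg p q hq
  set r : ℕ → Fin k → Fin (A + 1) := fun t j => e (p j t)
  let u : ℕ → Fin k → List σ := fun t j => (List.range t).map (p j)
  have hu : ∀ t j, SeqPrefix (u t j) (p j) := fun t j => seqPrefix_map_range _ _
  -- The counter in the data includes the symbol just selected, which is written only in the
  -- following round; hence the shift to `t + 1`.
  let W : ℕ → List (Fin (A + 1)) := fun t => loopWritten out next r (t + 1)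
  have hstate : ∀ t, (limitState (loopTrace out next r t).2 : LimitState σ k) =
      (t, (W t).length, u t) := by
    intro t
    induction t with
    -- The loop starts with the number `0`. Codes are shifted to be positive, so `0` decodes to the
    -- default: precision `0`, nothing written, nothing read.
    | zero => simp [limitState, loopTrace, decodeSucc, W, loopWritten, u]
    | succ t ih =>
      have h1 : limitState (loopTrace out next r (t + 1)).2 =
          limitNext e H (r t) (limitState (loopTrace out next r t).2) := by
        simp only [loopTrace, next]
        exact decodeSucc_encodeSucc _ _
      have h2 : W (t + 1) = W t ++
          (limitOut e H (r t) (limitState (loopTrace out next r t).2)).toList := rfl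
      have h3 : extendWords e (r t) (u t) = u (t + 1) := by
        funext j
        simp [extendWords, u, r, List.range_succ]
      rw [h1, h2, ih]
      simp only [limitNext, h3, List.length_append]
  have hW : ∀ t, W (t + 1) = W t ++ (((H (t + 1) (u (t + 1)))[(W t).length]?).map e).toList := by
    intro t
    have h2 : W (t + 1) = W t ++
        (limitOut e H (r t) (limitState (loopTrace out next r t).2)).toList := rfl
    have h3 : extendWords e (r t) (u t) = u (t + 1) := by
      funext j
      simp [extendWords, u, r, List.range_succ]
    rw [h2, hstate, limitOut, h3]
  have hW0 : W 0 = [] := rfl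
  -- Approximations from different rounds need not extend each other, but all are prefixes of `q`.
  -- Appending the symbol at position `(W t).length` of the current one is therefore always correct.
  have hval : ∀ t, SeqPrefix (W t) fun i => e (q i) := by
    intro t
    induction t with
    | zero => intro i a h; simp [hW0] at h
    | succ t ih =>
      intro i a h
      rw [hW, List.getElem?_append] at h
      split_ifs at h with hi
      · exact ih i a h
      · cases hx : (H (t + 1) (u (t + 1)))[(W t).length]? with
        | none => simp [hx] at h
        | some x =>
          rw [hx] at h
          have hi' : i = (W t).length := by
            by_contra hne
            have : i - (W t).length ≠ 0 := by omega
            obtain ⟨m, hm⟩ := Nat.exists_eq_succ_of_ne_zero this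
            simp [hm] at h
          subst hi'
          have := hs (t + 1) (u (t + 1)) (hu _) _ _ hx
          simp only [Nat.sub_self, Option.map_some, Option.toList_some,
            List.getElem?_cons_zero, Option.some.injEq] at h
          exact (congrArg e this).trans h
  have hmono : Monotone fun t => (W t).length :=
    monotone_nat_of_le_succ fun t => by simp [hW]
  -- Once `N` symbols are written and the precision guarantees `N + 1`, either a further symbol is
  -- already written or the next round supplies it.
  have hlen : ∀ N, ∃ t, N ≤ (W t).length := by
    intro N
    induction N with
    | zero => exact ⟨0, Nat.zero_le _⟩
    | succ N ih =>
      obtain ⟨t₁, ht₁⟩ := ih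
      obtain ⟨t₀, ht₀⟩ := hc (N + 1)
      have h1 := ht₀ (max t₀ t₁ + 1) (by omega) (u (max t₀ t₁ + 1))
        fun j => ⟨hu _ j, by simp [u]; omega⟩
      have h2 : N ≤ (W (max t₀ t₁)).length := ht₁.trans (hmono (le_max_right _ _))
      refine ⟨max t₀ t₁ + 1, ?_⟩
      rcases h2.lt_or_eq with h2 | h2
      · exact (Nat.succ_le_of_lt h2).trans (hmono (Nat.le_succ (max t₀ t₁)))
      · rw [hW, ← h2, List.getElem?_eq_getElem h1]
        simp [← h2]
  intro i
  obtain ⟨t, ht⟩ := hlen (i + 1)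
  refine ⟨t + 1, ?_⟩
  have h1 := List.getElem?_eq_getElem (l := W t) ht
  exact h1.trans (congrArg some (hval t _ _ h1).symm)

end OfApproximation

/-! ### Primitive recursive simulation of tapes -/

/-- A finite type, with an arbitrary enumeration. -/
@[reducible] noncomputable def primcodableOfFinite (α : Type*) [Finite α] : Primcodable α :=
  Primcodable.ofEquiv (Fin (Nat.card α)) (Finite.equivFin α)

section Tapes

/-- Reduces the primitive recursiveness of a machine step to that of single instructions. The
program is a function on a finite set and need not be encoded. -/
theorem Primrec.finite_cases {ι α β : Type*} [Finite ι] [Primcodable ι] [Primcodable α]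
    [Primcodable β] {f : ι → α → β} (hf : ∀ i, Primrec (f i)) : Primrec₂ f := by
  let e := Finite.equivFin ι
  have h : Primrec₂ fun (m : Fin (Nat.card ι)) a => f (e.symm m) a :=
    Primrec.fin_curry₁.2 fun m => hf _
  refine (h.comp ((Primrec.dom_finite e).comp Primrec.fst) Primrec.snd).of_eq fun x => ?_
  simp

theorem Primrec.apply {m : ℕ} {α : Type*} [Primcodable α] (i : Fin m) :
    Primrec fun f : Fin m → α => f i :=
  Primrec.fin_app.comp Primrec.id (Primrec.const i)

theorem Primrec.update {m : ℕ} {α : Type*} [Primcodable α] (i : Fin m) :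
    Primrec₂ fun (f : Fin m → α) (a : α) => Function.update f i a := by
  refine Primrec.fin_curry.2 ?_
  refine (Primrec.ite (Primrec.eq.comp Primrec.snd (Primrec.const i))
    (Primrec.snd.comp Primrec.fst)
    (Primrec.fin_app.comp (Primrec.fst.comp Primrec.fst) Primrec.snd)).of_eq ?_
  rintro ⟨⟨f, a⟩, j⟩
  by_cases h : j = i
  · subst h; simp
  · simp [h]

/-- An integer `n ≥ 0` has the code `2 * n` and `-(n + 1)` has the code `2 * n + 1`. Adding one thus
raises even codes by `2` and lowers odd codes by `2`; truncated subtraction takes the code `1` of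
`-1` to `0`. -/
theorem Primrec.int_add_one : Primrec fun z : ℤ => z + 1 := by
  refine Primrec.encode_iff.1 ((Primrec.ite (Primrec.eq.comp
    (Primrec.nat_mod.comp Primrec.id (Primrec.const 2)) (Primrec.const 0))
    (Primrec.nat_add.comp Primrec.id (Primrec.const 2))
    (Primrec.nat_sub.comp Primrec.id (Primrec.const 2))).comp
    (Primrec.encode (α := ℤ)) |>.of_eq ?_)
  rintro (n | n)
  · show (if (2 * n) % 2 = 0 then 2 * n + 2 else 2 * n - 2) = 2 * (n + 1)
    rw [if_pos (by omega)]
    ring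
  · show (if (2 * n + 1) % 2 = 0 then 2 * n + 1 + 2 else 2 * n + 1 - 2) = _
    rw [if_neg (by omega)]
    cases n with
    | zero => rfl
    | succ n =>
      rw [show Int.negSucc (n + 1) + 1 = Int.negSucc n by omega]
      show _ = 2 * n + 1
      omega

/-- In the same coding, even codes are lowered by `2` and odd ones raised by `2`. The code `0` is
the exception and goes to `1`, the code of `-1`. -/
theorem Primrec.int_sub_one : Primrec fun z : ℤ => z - 1 := by
  refine Primrec.encode_iff.1 ((Primrec.ite (Primrec.eq.comp
    (Primrec.nat_mod.comp Primrec.id (Primrec.const 2)) (Primrec.const 0))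
    (Primrec.ite (Primrec.eq.comp Primrec.id (Primrec.const 0)) (Primrec.const 1)
      (Primrec.nat_sub.comp Primrec.id (Primrec.const 2)))
    (Primrec.nat_add.comp Primrec.id (Primrec.const 2))).comp
    (Primrec.encode (α := ℤ)) |>.of_eq ?_)
  rintro (n | n)
  · show (if (2 * n) % 2 = 0 then (if 2 * n = 0 then 1 else 2 * n - 2) else 2 * n + 2) = _
    rw [if_pos (by omega)]
    cases n with
    | zero => rfl
    | succ n =>
      rw [if_neg (by omega), show Int.ofNat (n + 1) - 1 = Int.ofNat n by simp]
      show _ = 2 * n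
      omega
  · show (if (2 * n + 1) % 2 = 0 then (if 2 * n + 1 = 0 then 1 else 2 * n + 1 - 2)
      else 2 * n + 1 + 2) = _
    rw [if_neg (by omega), show Int.negSucc n - 1 = Int.negSucc (n + 1) by omega]
    show _ = 2 * (n + 1) + 1
    omega

/-- The inscriptions of `m` tapes, given by the list of all write operations, the latest first. -/
abbrev TapeLog (m : ℕ) (C : Type*) := List ((Fin m × ℤ) × C)

variable {m : ℕ} {C : Type*}

/-- The content of a cell. -/
def TapeLog.get (blank : C) (l : TapeLog m C) (i : Fin m) (z : ℤ) : C :=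
  l.foldr (fun x c => if x.1 = (i, z) then x.2 else c) blank

theorem TapeLog.get_cons (blank : C) (l : TapeLog m C) (i : Fin m) (z : ℤ) (c : C) :
    TapeLog.get blank (((i, z), c) :: l) =
      Function.update (TapeLog.get blank l) i
        (Function.update (TapeLog.get blank l i) z c) := by
  funext i' z'
  by_cases hi : i' = i
  · subst hi
    by_cases hz : z' = z
    · subst hz
      simp [TapeLog.get]
    · simp [TapeLog.get, hz, Ne.symm hz]
  · simp [TapeLog.get, hi, Ne.symm hi]

theorem TapeLog.primrec_get [Primcodable C] (blank : C) (i : Fin m) :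
    Primrec₂ fun (l : TapeLog m C) z => TapeLog.get blank l i z := by
  refine Primrec.list_foldr (α := TapeLog m C × ℤ)
    (h := fun a x => if x.1.1 = (i, a.2) then x.1.2 else x.2)
    Primrec.fst (Primrec.const blank) ?_
  exact Primrec.ite (Primrec.eq.comp (Primrec.fst.comp (Primrec.fst.comp Primrec.snd))
    (Primrec.pair (Primrec.const i) (Primrec.snd.comp Primrec.fst)))
    (Primrec.snd.comp (Primrec.fst.comp Primrec.snd)) (Primrec.snd.comp Primrec.snd)

end Tapes

/-! ### Simulation of Type-2 machines on words -/

section WordSimulation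

variable {σ : Type s} {k m : ℕ} {Γ Q : Type}

/-- The data of a configuration apart from the state. -/
abbrev WordData (σ : Type s) (k m : ℕ) (Γ : Type) :=
  (Fin k → ℕ) × TapeLog m Γ × (Fin m → ℤ) × List σ

/-- Execute an instruction in state `q` on the input words `u`; nothing happens if it
reads beyond the end of an input word. -/
def wordExec (blank : Γ) (q : Q) (u : Fin k → List σ) (d : WordData σ k m Γ) :
    Type2Instr σ k m Γ Q → Q × WordData σ k m Γ
  | .halt => (q, d)
  | .inBranch j next => (((u j)[d.1 j]?.map next).getD q, d)
  | .inRight j next => (next, Function.update d.1 j (d.1 j + 1), d.2)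
  | .branch i next => (next (TapeLog.get blank d.2.1 i (d.2.2.1 i)), d)
  | .right i next =>
      (next, d.1, d.2.1, Function.update d.2.2.1 i (d.2.2.1 i + 1), d.2.2.2)
  | .left i next =>
      (next, d.1, d.2.1, Function.update d.2.2.1 i (d.2.2.1 i - 1), d.2.2.2)
  | .write i a next => (next, d.1, ((i, d.2.2.1 i), a) :: d.2.1, d.2.2)
  | .out a next => (next, d.1, d.2.1, d.2.2.1, d.2.2.2 ++ [a])

theorem primrec_wordExec [Primcodable σ] [Primcodable Γ] [Primcodable Q] [Finite σ] [Finite Γ]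
    (blank : Γ) (q : Q) (I : Type2Instr σ k m Γ Q) :
    Primrec fun x : (Fin k → List σ) × WordData σ k m Γ => wordExec blank q x.1 x.2 I := by
  have hpos : Primrec fun x : (Fin k → List σ) × WordData σ k m Γ => x.2.1 :=
    Primrec.fst.comp Primrec.snd
  have hlog : Primrec fun x : (Fin k → List σ) × WordData σ k m Γ => x.2.2.1 :=
    Primrec.fst.comp (Primrec.snd.comp Primrec.snd)
  have hhead : Primrec fun x : (Fin k → List σ) × WordData σ k m Γ => x.2.2.2.1 :=
    Primrec.fst.comp (Primrec.snd.comp (Primrec.snd.comp Primrec.snd))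
  have hout : Primrec fun x : (Fin k → List σ) × WordData σ k m Γ => x.2.2.2.2 :=
    Primrec.snd.comp (Primrec.snd.comp (Primrec.snd.comp Primrec.snd))
  cases I with
  | halt => exact Primrec.pair (Primrec.const q) Primrec.snd
  | inBranch j next =>
    exact Primrec.pair (Primrec.option_getD.comp
      (Primrec.option_map (Primrec.list_getElem?.comp ((Primrec.apply j).comp Primrec.fst)
        ((Primrec.apply j).comp hpos)) ((Primrec.dom_finite next).comp₂ Primrec₂.right))
      (Primrec.const q)) Primrec.snd
  | inRight j next =>
    exact Primrec.pair (Primrec.const next) (Primrec.pair ((Primrec.update j).comp hpos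
      (Primrec.succ.comp ((Primrec.apply j).comp hpos))) (Primrec.snd.comp Primrec.snd))
  | branch i next =>
    exact Primrec.pair ((Primrec.dom_finite next).comp
      ((TapeLog.primrec_get blank i).comp hlog ((Primrec.apply i).comp hhead))) Primrec.snd
  | right i next =>
    exact Primrec.pair (Primrec.const next) (Primrec.pair hpos (Primrec.pair hlog
      (Primrec.pair ((Primrec.update i).comp hhead
        (Primrec.int_add_one.comp ((Primrec.apply i).comp hhead))) hout)))
  | left i next =>
    exact Primrec.pair (Primrec.const next) (Primrec.pair hpos (Primrec.pair hlog
      (Primrec.pair ((Primrec.update i).comp hhead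
        (Primrec.int_sub_one.comp ((Primrec.apply i).comp hhead))) hout)))
  | write i a next =>
    exact Primrec.pair (Primrec.const next) (Primrec.pair hpos (Primrec.pair
      (Primrec.list_cons.comp (Primrec.pair (Primrec.pair (Primrec.const i) ((Primrec.apply i).comp hhead))
        (Primrec.const a)) hlog) (Primrec.pair hhead hout)))
  | out a next =>
    exact Primrec.pair (Primrec.const next) (Primrec.pair hpos (Primrec.pair hlog
      (Primrec.pair hhead (Primrec.list_append.comp hout (Primrec.const [a])))))

end WordSimulation

/-! ### The simulated computation on prefixes of the input -/

section WordSimulation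

variable {σ : Type s} {k : ℕ}

/-- The configurations of the simulation of a Type-2 machine on words. -/
abbrev WordConfig (M : Type2Machine σ k) := M.Q × WordData σ k M.m M.Γ

/-- One step of the simulation on input words `u`. -/
def wordStep (M : Type2Machine σ k) (u : Fin k → List σ) (c : WordConfig M) : WordConfig M :=
  wordExec M.blank c.1 u c.2 (M.instr c.1)

/-- The configuration after `t` steps of the simulation on input words `u`. -/
def wordRun (M : Type2Machine σ k) (t : ℕ) (u : Fin k → List σ) : WordConfig M :=
  (wordStep M u)^[t] (M.start, fun _ => 0, [], fun _ => 0, [])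

/-- The configuration described by a configuration of the simulation. -/
def WordConfig.toConfig {M : Type2Machine σ k} (c : WordConfig M) : M.Config :=
  ⟨c.1, c.2.1, TapeLog.get M.blank c.2.2.1, c.2.2.2.1, c.2.2.2.2⟩

theorem primrec_wordRun (M : Type2Machine σ k) [Primcodable σ] [Finite σ] [Primcodable M.Q]
    [Primcodable M.Γ] : Primrec₂ (wordRun M) := by
  have := M.finite_Q
  have := M.finite_Γ
  have h : Primrec₂ fun (q : M.Q) (x : (Fin k → List σ) × WordData σ k M.m M.Γ) =>
      wordExec M.blank q x.1 x.2 (M.instr q) :=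
    Primrec.finite_cases fun q => primrec_wordExec M.blank q (M.instr q)
  refine Primrec.nat_iterate Primrec.fst (Primrec.const _) ?_
  exact h.comp (Primrec.fst.comp Primrec.snd) (Primrec.pair (Primrec.snd.comp Primrec.fst)
    (Primrec.snd.comp Primrec.snd))

variable {M : Type2Machine σ k} {p : Fin k → ℕ → σ} {u : Fin k → List σ}

/-- Only `inBranch` consults the input. If the head is inside the given word, the symbol there is
that of `p`; otherwise the simulation pauses. -/
theorem step_toConfig (hu : ∀ j, SeqPrefix (u j) (p j)) (c : WordConfig M) :
    wordStep M u c = c ∨ M.step p c.toConfig = some (wordStep M u c).toConfig := by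
  obtain ⟨q, pos, log, head, out⟩ := c
  simp only [wordStep, Type2Machine.step, WordConfig.toConfig]
  cases hI : M.instr q with
  | halt => exact .inl rfl
  | inBranch j next =>
    simp only [wordExec]
    cases hx : (u j)[pos j]? with
    | none => exact .inl rfl
    | some x => exact .inr (by rw [hu j _ _ hx]; rfl)
  | write i a next => exact .inr (by simp only [wordExec, TapeLog.get_cons])
  | _ => exact .inr rfl

/-- With all input heads inside the given words the simulation never has to pause. -/
theorem toConfig_wordStep (hu : ∀ j, SeqPrefix (u j) (p j)) {c : WordConfig M}
    (hpos : ∀ j, c.2.1 j < (u j).length) {c' : M.Config}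
    (h : M.step p c.toConfig = some c') : (wordStep M u c).toConfig = c' := by
  obtain ⟨q, pos, log, head, out⟩ := c
  simp only [wordStep]
  simp only [Type2Machine.step, WordConfig.toConfig] at h ⊢
  cases hI : M.instr q with
  | halt => simp [hI] at h
  | inBranch j next =>
    simp only [hI] at h
    cases h
    have hx := List.getElem?_eq_getElem (hpos j)
    simp only at hx
    simp only [wordExec, hx, hu j _ _ hx]
    rfl
  | write i a next =>
    simp only [hI] at h
    cases h
    simp only [wordExec, TapeLog.get_cons]
  | _ =>
    simp only [hI] at h
    cases h
    rfl

/-- Bounds head positions by time: after `t` steps no head is beyond position `t`, so prefixes of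
length `t + 1` suffice for `t + 1` steps. -/
theorem inPos_wordStep_le (c : WordConfig M) (j : Fin k) :
    (wordStep M u c).2.1 j ≤ c.2.1 j + 1 := by
  obtain ⟨q, pos, log, head, out⟩ := c
  simp only [wordStep]
  cases hI : M.instr q with
  | inRight j' next =>
    simp only [wordExec]
    by_cases h : j = j'
    · subst h; simp
    · simp [Function.update_of_ne h]
  | _ => exact Nat.le_succ _

theorem length_output_le_wordStep (c : WordConfig M) :
    c.2.2.2.2.length ≤ (wordStep M u c).2.2.2.2.length := by
  obtain ⟨q, pos, log, head, out⟩ := c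
  simp only [wordStep]
  cases hI : M.instr q with
  | out a next => simp [wordExec]
  | _ => exact le_rfl

theorem wordRun_succ (t : ℕ) : wordRun M (t + 1) u = wordStep M u (wordRun M t u) :=
  Function.iterate_succ_apply' _ _ _

theorem length_output_wordRun_mono : Monotone fun t => (wordRun M t u).2.2.2.2.length :=
  monotone_nat_of_le_succ fun t => by
    rw [wordRun_succ]
    exact length_output_le_wordStep _

/-- The simulation on prefixes of `p` visits only configurations of the computation on `p`. -/
theorem exists_run_eq_wordRun (hu : ∀ j, SeqPrefix (u j) (p j)) (t : ℕ) :
    ∃ n, M.run p n = some (wordRun M t u).toConfig := by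
  induction t with
  | zero => exact ⟨0, rfl⟩
  | succ t ih =>
    obtain ⟨n, hn⟩ := ih
    rw [wordRun_succ]
    rcases step_toConfig hu (wordRun M t u) with h | h
    · exact ⟨n, by rw [h, hn]⟩
    · exact ⟨n + 1, by rw [Type2Machine.run, hn]; exact h⟩

/-- The simulation on sufficiently long prefixes of `p` agrees with the computation on `p`. -/
theorem wordRun_toConfig (hu : ∀ j, SeqPrefix (u j) (p j)) (t : ℕ) (ht : ∀ j, t ≤ (u j).length)
    {c : M.Config} (hc : M.run p t = some c) :
    (wordRun M t u).toConfig = c ∧ ∀ j, (wordRun M t u).2.1 j ≤ t := by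
  induction t generalizing c with
  | zero =>
    cases hc
    exact ⟨rfl, fun _ => le_rfl⟩
  | succ t ih =>
    rw [Type2Machine.run, Option.bind_eq_some_iff] at hc
    obtain ⟨c₀, h₀, h₁⟩ := hc
    obtain ⟨h2, h3⟩ := ih (fun j => (Nat.le_succ t).trans (ht j)) h₀
    rw [wordRun_succ]
    subst h2
    exact ⟨toConfig_wordStep hu (fun j => (h3 j).trans_lt (ht j)) h₁,
      fun j => (inPos_wordStep_le _ j).trans (Nat.succ_le_succ (h3 j))⟩

theorem Type2Machine.output_isPrefix {n n' : ℕ} (h : n ≤ n') {c c' : M.Config}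
    (hc : M.run p n = some c) (hc' : M.run p n' = some c') : c.output <+: c'.output := by
  induction n', h using Nat.le_induction generalizing c' with
  | base =>
    rw [hc] at hc'
    cases hc'
    exact List.prefix_rfl
  | succ n' _ ih =>
    rw [Type2Machine.run, Option.bind_eq_some_iff] at hc'
    obtain ⟨c₁, h₁, h₂⟩ := hc'
    refine (ih h₁).trans ?_
    unfold Type2Machine.step at h₂
    split at h₂ <;> cases h₂ <;> first | exact List.prefix_rfl | exact List.prefix_append _ _

/-- The output is never erased, so of the words written at any two times one is a prefix of the
other; compare with a time at which the symbol of `q` in question has been written. -/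
theorem Type2Machine.YieldsSeq.seqPrefix {q : ℕ → σ} (h : M.YieldsSeq p q) {n : ℕ} {c : M.Config}
    (hc : M.run p n = some c) : SeqPrefix c.output q := by
  intro i a ha
  obtain ⟨n', c', hc', hi⟩ := h.2 i
  rcases le_total n n' with hn | hn
  · have := (List.prefix_iff_getElem?.1 (output_isPrefix hn hc hc') i
      (List.getElem?_eq_some_iff.1 ha).1)
    rw [hi] at this
    rw [(List.getElem?_eq_some_iff.1 ha).2] at this
    exact Option.some.inj this
  · have := (List.prefix_iff_getElem?.1 (output_isPrefix hn hc' hc) i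
      (List.getElem?_eq_some_iff.1 hi).1)
    rw [ha, (List.getElem?_eq_some_iff.1 hi).2] at this
    exact (Option.some.inj this).symm

theorem Type2Machine.step_eq_none_iff {c : M.Config} :
    M.step p c = none ↔ M.instr c.state = .halt := by
  unfold Type2Machine.step
  split <;> simp_all

/-- A computable function is approximated by a primitive recursive function on words. -/
theorem ComputableToSeq.exists_approximates [Primcodable σ] [Finite σ]
    {g : (Fin k → ℕ → σ) →. (ℕ → σ)} (hg : ComputableToSeq g) :
    ∃ h : ℕ → (Fin k → List σ) → List σ, Primrec₂ h ∧ ApproximatesSeq h g.toMultiFun := by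
  obtain ⟨M, hM⟩ := hg
  have := M.finite_Q
  have := M.finite_Γ
  let _ := primcodableOfFinite M.Q
  let _ := primcodableOfFinite M.Γ
  refine ⟨fun t u => (wordRun M t u).2.2.2.2, ?_, fun p q hq => ⟨fun t u hu => ?_, fun N => ?_⟩⟩
  · exact (Primrec.snd.comp (Primrec.snd.comp (Primrec.snd.comp Primrec.snd))).comp₂
      (primrec_wordRun M)
  · obtain ⟨n, hn⟩ := exists_run_eq_wordRun (M := M) hu t
    exact (hM p q hq).seqPrefix hn
  · obtain ⟨n, c, hc, hi⟩ := (hM p q hq).2 N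
    have hN : N < c.output.length := (List.getElem?_eq_some_iff.1 hi).1
    refine ⟨n, fun t ht u hu => ?_⟩
    have h1 := (wordRun_toConfig (fun j => (hu j).1) n (fun j => (hu j).2) hc).1
    refine le_trans ?_ (length_output_wordRun_mono (M := M) (u := u) ht)
    rw [← h1] at hN
    exact hN.le

/-- A computable function to words is approximated by a primitive recursive function on words. -/
theorem ComputableToWord.exists_approximates [Primcodable σ] [Finite σ]
    {g : (Fin k → ℕ → σ) →. List σ} (hg : ComputableToWord g) :
    ∃ h : ℕ → (Fin k → List σ) → Option (List σ), Primrec₂ h ∧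
      ApproximatesWord h g.toMultiFun := by
  classical
  obtain ⟨M, hM⟩ := hg
  have := M.finite_Q
  have := M.finite_Γ
  let _ := primcodableOfFinite M.Q
  let _ := primcodableOfFinite M.Γ
  let halted : M.Q → Bool := fun q => decide (M.instr q = .halt)
  let h : ℕ → (Fin k → List σ) → Option (List σ) := fun t u =>
    bif halted (wordRun M t u).1 then some (wordRun M t u).2.2.2.2 else none
  have hsound : ∀ p, ∀ w ∈ g p, ∀ t u, (∀ j, SeqPrefix (u j) (p j)) → ∀ w' ∈ h t u, w' = w := by
    intro p w hw t u hu w' hw'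
    obtain ⟨n, c, hc, hstep, rfl⟩ := hM p w hw
    obtain ⟨n', hn'⟩ := exists_run_eq_wordRun (M := M) hu t
    simp only [h, cond_eq_ite] at hw'
    split_ifs at hw' with hh
    · have hw'' : (wordRun M t u).2.2.2.2 = w' := by simpa using hw'
      have hstep' : M.step p (wordRun M t u).toConfig = none :=
        Type2Machine.step_eq_none_iff.2 (of_decide_eq_true hh)
      -- No configuration exists after the halting time. Hence the simulated halting configuration
      -- and the true one occur at the same time and are equal.
      have hnn : ∀ {a b : ℕ} {c c' : M.Config}, M.run p a = some c → M.step p c = none →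
          M.run p b = some c' → b ≤ a := by
        intro a b c c' ha hs hb
        by_contra hlt
        have := Type2Machine.run_isSome_of_le (Nat.succ_le_of_lt (not_le.1 hlt)) (M := M) (p := p)
          (by rw [hb]; rfl)
        rw [Nat.succ_eq_add_one, Type2Machine.run, ha, Option.bind_some, hs] at this
        cases this
      have := le_antisymm (hnn hc hstep hn') (hnn hn' hstep' hc)
      subst this
      rw [hn'] at hc
      cases hc
      exact hw''.symm
    · cases hw'
  refine ⟨h, ?_, fun p w hw => ⟨hsound p w hw, ?_⟩⟩
  · refine Primrec.cond ((Primrec.dom_finite halted).comp (Primrec.fst.comp (primrec_wordRun M)))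
      (Primrec.option_some.comp ?_) (Primrec.const none)
    exact (Primrec.snd.comp (Primrec.snd.comp (Primrec.snd.comp Primrec.snd))).comp
      (primrec_wordRun M)
  · obtain ⟨n, c, hc, hstep, -⟩ := hM p w hw
    refine ⟨n, fun t ht u hu => ?_⟩
    have hu' : ∀ j, SeqPrefix (u j) (p j) := fun j => (hu j).1
    have h1 := (wordRun_toConfig hu' n (fun j => (hu j).2) hc).1
    have hhalt : M.instr (wordRun M n u).1 = .halt := by
      rw [← h1] at hstep
      exact Type2Machine.step_eq_none_iff.1 hstep
    have hstay : wordRun M t u = wordRun M n u := by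
      induction t, ht using Nat.le_induction with
      | base => rfl
      | succ t _ ih => rw [wordRun_succ, ih, wordStep, hhalt]; rfl
    have h2 : h t u = some (wordRun M t u).2.2.2.2 := by
      simp [h, halted, hstay, hhalt]
    rw [h2, hsound p w hw t u hu' _ h2]

end WordSimulation

/-! ### Replacing objects by names -/

section Names

variable {σ : Type s} {zero one : σ} {k L : ℕ} {Z : Fin (L + 1) → Type u}

/-- A statement on names realizes a statement on objects. -/
inductive StmtRealizes {Γ Lab : Type v} (δ : ∀ i, MultiRep σ (Z i)) :
    GTMStmt σ zero one (fun _ : Fin (L + 1) => ℕ → σ) Γ Lab →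
      GTMStmt σ zero one Z Γ Lab → Prop
  | right (i l') : StmtRealizes δ (.right i l') (.right i l')
  | left (i l') : StmtRealizes δ (.left i l') (.left i l')
  | write (i a l') : StmtRealizes δ (.write i a l') (.write i a l')
  | branch (i a l' l'') : StmtRealizes δ (.branch i a l' l'') (.branch i a l' l'')
  | assign {n : ℕ} (i) (idx : Fin n → Fin (L + 1)) (g f l')
      (h : Realizes (fun j => (δ (idx j)).toFun) (δ i).toFun g f) :
      StmtRealizes δ (.assign i idx g l') (.assign i idx f l')
  | test {n : ℕ} (idx : Fin n → Fin (L + 1)) (g : (Fin n → ℕ → σ) →. List σ) (hg)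
      (f : (∀ j, Z (idx j)) →. List σ) (hf l' l'')
      (h : Realizes (fun j => (δ (idx j)).toFun) (fun x : List σ => {x})
        g.toMultiFun f.toMultiFun) :
      StmtRealizes δ (.test idx g hg l' l'') (.test idx f hf l' l'')

/-- The machine with the same labels and symbols as `P` that works on names. -/
def GTM.onNames (P : GTM.{u, v, s} σ zero one k Z)
    (stm : ∀ l, l ≠ P.lf → GTMStmt σ zero one (fun _ : Fin (L + 1) => ℕ → σ) P.Γ P.Lab) :
    GTM.{s, v, s} σ zero one k (fun _ : Fin (L + 1) => ℕ → σ) where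
  Lab := P.Lab
  Γ := P.Γ
  finite_Lab := P.finite_Lab
  finite_Γ := P.finite_Γ
  k_le := P.k_le
  l₀ := P.l₀
  lf := P.lf
  blank := P.blank
  stm := stm

/-- Some computation on `p` reaches the final label with `q` in cell `0` of tape `0`. -/
def GTM.Outputs (N : GTM.{u, v, s} σ zero one k Z) (p : ∀ j, Z (N.inTape j)) (q : Z 0) : Prop :=
  ∃ c, Relation.ReflTransGen N.Step (N.initial p) c ∧ c.label = N.lf ∧ c.tape 0 0 = Sum.inr q

theorem GTM.Config.setCell_tape_self {N : GTM.{u, v, s} σ zero one k Z} (c : N.Config)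
    (i : Fin (L + 1)) (y : N.Γ ⊕ Z i) : (c.setCell i y).tape i (c.head i) = y := by
  simp [GTM.Config.setCell]

theorem GTM.Config.setCell_tape_of_ne_head {N : GTM.{u, v, s} σ zero one k Z} (c : N.Config)
    (i : Fin (L + 1)) (y : N.Γ ⊕ Z i) {z : ℤ} (hz : z ≠ c.head i) :
    (c.setCell i y).tape i z = c.tape i z := by
  simp [GTM.Config.setCell, hz]

theorem GTM.Config.setCell_tape_of_ne {N : GTM.{u, v, s} σ zero one k Z} (c : N.Config)
    (i : Fin (L + 1)) (y : N.Γ ⊕ Z i) {i' : Fin (L + 1)} (hi : i' ≠ i) (z : ℤ) :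
    (c.setCell i y).tape i' z = c.tape i' z := by
  simp [GTM.Config.setCell, hi]

variable {P : GTM.{u, v, s} σ zero one k Z} {δ : ∀ i, MultiRep σ (Z i)}
  {stm : ∀ l, l ≠ P.lf → GTMStmt σ zero one (fun _ : Fin (L + 1) => ℕ → σ) P.Γ P.Lab}

/-- A configuration on names describes a configuration on objects. -/
structure Describes (δ : ∀ i, MultiRep σ (Z i)) (c' : (P.onNames stm).Config) (c : P.Config) :
    Prop where
  label : c'.label = c.label
  head : c'.head = c.head
  tape : ∀ i z, Sum.LiftRel (fun a b : P.Γ => a = b) (fun q x => x ∈ (δ i).toFun q)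
    (c'.tape i z) (c.tape i z)

theorem Describes.goto {c' : (P.onNames stm).Config} {c : P.Config} (h : Describes δ c' c)
    (l : P.Lab) : Describes δ (c'.goto l) (c.goto l) :=
  ⟨rfl, h.head, h.tape⟩

theorem Describes.setHead {c' : (P.onNames stm).Config} {c : P.Config} (h : Describes δ c' c)
    (i : Fin (L + 1)) (m : ℤ) : Describes δ (c'.setHead i m) (c.setHead i m) :=
  ⟨h.label, by simp only [GTM.Config.setHead, h.head], h.tape⟩

theorem Describes.setCell {c' : (P.onNames stm).Config} {c : P.Config} (h : Describes δ c' c)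
    (i : Fin (L + 1)) {y' : P.Γ ⊕ (ℕ → σ)} {y : P.Γ ⊕ Z i}
    (hy : Sum.LiftRel (fun a b : P.Γ => a = b) (fun q x => x ∈ (δ i).toFun q) y' y) :
    Describes δ (c'.setCell i y') (c.setCell i y) := by
  refine ⟨h.label, h.head, fun i' z => ?_⟩
  have hh : c'.head i' = c.head i' := by rw [h.head]
  by_cases hi : i' = i
  · subst hi
    by_cases hz : z = c.head i'
    · have h1 := c'.setCell_tape_self i' y'
      rw [hh] at h1
      subst hz
      rw [c.setCell_tape_self, h1]
      exact hy
    · rw [c.setCell_tape_of_ne_head i' y hz, c'.setCell_tape_of_ne_head i' y' (hh ▸ hz)]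
      exact h.tape i' z
  · rw [c.setCell_tape_of_ne i y hi z, c'.setCell_tape_of_ne i y' hi z]
    exact h.tape i' z

theorem Describes.scan {c' : (P.onNames stm).Config} {c : P.Config} (h : Describes δ c' c)
    (i : Fin (L + 1)) : Sum.LiftRel (fun a b : P.Γ => a = b) (fun q x => x ∈ (δ i).toFun q)
      (c'.scan i) (c.scan i) := by
  simpa [GTM.Config.scan, h.head] using h.tape i (c.head i)

theorem Describes.scan_eq_inl_iff {c' : (P.onNames stm).Config} {c : P.Config}
    (h : Describes δ c' c) (i : Fin (L + 1)) (a : P.Γ) :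
    c'.scan i = Sum.inl a ↔ c.scan i = Sum.inl a := by
  have := h.scan i
  revert this
  generalize c'.scan i = x
  generalize c.scan i = y
  rintro (⟨rfl⟩ | h)
  · exact ⟨fun h => by cases h; rfl, fun h => by cases h; rfl⟩
  · exact ⟨fun h => (Sum.inr_ne_inl h).elim, fun h => (Sum.inr_ne_inl h).elim⟩

theorem Describes.exists_name {c' : (P.onNames stm).Config} {c : P.Config}
    (h : Describes δ c' c) {i : Fin (L + 1)} {z : ℤ} {x : Z i} (hx : c.tape i z = Sum.inr x) :
    ∃ q, c'.tape i z = Sum.inr q ∧ x ∈ (δ i).toFun q := by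
  have := h.tape i z
  rw [hx] at this
  revert this
  generalize c'.tape i z = y
  rintro (_ | hq)
  exact ⟨_, rfl, hq⟩

theorem Describes.exists_object {c' : (P.onNames stm).Config} {c : P.Config}
    (h : Describes δ c' c) {i : Fin (L + 1)} {z : ℤ} {q : ℕ → σ} (hq : c'.tape i z = Sum.inr q) :
    ∃ x, c.tape i z = Sum.inr x ∧ x ∈ (δ i).toFun q := by
  have := h.tape i z
  rw [hq] at this
  revert this
  generalize c.tape i z = y
  rintro (_ | hx)
  exact ⟨_, rfl, hx⟩

theorem Describes.exists_names {c' : (P.onNames stm).Config} {c : P.Config}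
    (h : Describes δ c' c) {n : ℕ} {idx : Fin n → Fin (L + 1)} {x : ∀ j, Z (idx j)}
    (hx : ∀ j, c.scan (idx j) = Sum.inr (x j)) :
    ∃ q : Fin n → ℕ → σ, (∀ j, c'.scan (idx j) = Sum.inr (q j)) ∧
      ∀ j, x j ∈ (δ (idx j)).toFun (q j) := by
  have : ∀ j, ∃ q, c'.scan (idx j) = Sum.inr q ∧ x j ∈ (δ (idx j)).toFun q := fun j => by
    obtain ⟨q, hq, hx⟩ := h.exists_name (hx j)
    exact ⟨q, by rw [GTM.Config.scan, h.head]; exact hq, hx⟩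
  choose q hq using this
  exact ⟨q, fun j => (hq j).1, fun j => (hq j).2⟩

/-- That `P` can continue from `c` means that the arguments lie in the domain of the function in the
statement; only then does the realization say anything. The successor `d` is chosen after the name
`r` is known, as an object with this name, so it may differ from the successor provided by `hc`. -/
theorem Describes.effect {c' d' : (P.onNames stm).Config} {c : P.Config} (h : Describes δ c' c)
    {s' : GTMStmt σ zero one (fun _ : Fin (L + 1) => ℕ → σ) P.Γ P.Lab}
    {s : GTMStmt σ zero one Z P.Γ P.Lab} (hs : StmtRealizes δ s' s)
    (hc : ∃ d, P.Effect c d s) (hd' : (P.onNames stm).Effect c' d' s') :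
    ∃ d, P.Effect c d s ∧ Describes δ d' d := by
  cases hs with
  | right i l' =>
    obtain rfl := hd'
    refine ⟨_, rfl, ?_⟩
    rw [h.head]
    exact (h.setHead i _).goto l'
  | left i l' =>
    obtain rfl := hd'
    refine ⟨_, rfl, ?_⟩
    rw [h.head]
    exact (h.setHead i _).goto l'
  | write i a l' =>
    obtain rfl := hd'
    exact ⟨_, rfl, (h.setCell i (.inl rfl)).goto l'⟩
  | branch i a l' l'' =>
    rcases hd' with ⟨h1, rfl⟩ | ⟨h1, rfl⟩
    · exact ⟨_, .inl ⟨(h.scan_eq_inl_iff i a).1 h1, rfl⟩, h.goto l'⟩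
    · exact ⟨_, .inr ⟨fun h2 => h1 ((h.scan_eq_inl_iff i a).2 h2), rfl⟩, h.goto l''⟩
  | assign i idx g f l' hgf =>
    obtain ⟨_, x, hx, y₀, hy₀, -⟩ := hc
    obtain ⟨q', hq', r, hr, rfl⟩ := hd'
    obtain ⟨q, hq, hxq⟩ := h.exists_names hx
    obtain rfl : q' = q := funext fun j => Sum.inr.inj ((hq' j).symm.trans (hq j))
    obtain ⟨y, hy, hyr⟩ := (hgf _ x hxq ⟨y₀, hy₀⟩).2 r hr
    exact ⟨_, ⟨x, hx, y, hy, rfl⟩, (h.setCell i (.inr hyr)).goto l'⟩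
  | test idx g hg f hf l' l'' hgf =>
    obtain ⟨_, x, hx, hfx⟩ := hc
    obtain ⟨q', hq', hd'⟩ := hd'
    obtain ⟨q, hq, hxq⟩ := h.exists_names hx
    obtain rfl : q' = q := funext fun j => Sum.inr.inj ((hq' j).symm.trans (hq j))
    have hne : (f.toMultiFun x).Nonempty := by
      rcases hfx with ⟨hfx, -⟩ | ⟨hfx, -⟩ <;> exact ⟨_, hfx⟩
    have hval : ∀ w ∈ g q', w ∈ f x := fun w hw => by
      obtain ⟨w', hw', rfl⟩ := (hgf _ x hxq hne).2 w hw
      exact hw'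
    rcases hd' with ⟨hw, rfl⟩ | ⟨hw, rfl⟩
    · exact ⟨_, ⟨x, hx, .inl ⟨hval _ hw, rfl⟩⟩, h.goto l'⟩
    · exact ⟨_, ⟨x, hx, .inr ⟨hval _ hw, rfl⟩⟩, h.goto l''⟩

/-- On names of arguments in the domain a realization has a value. For a test this value is one of
the two branching words by the condition imposed on tests. -/
theorem Describes.exists_effect {c' : (P.onNames stm).Config} {c : P.Config}
    (h : Describes δ c' c)
    {s' : GTMStmt σ zero one (fun _ : Fin (L + 1) => ℕ → σ) P.Γ P.Lab}
    {s : GTMStmt σ zero one Z P.Γ P.Lab} (hs : StmtRealizes δ s' s)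
    (hc : ∃ d, P.Effect c d s) : ∃ d', (P.onNames stm).Effect c' d' s' := by
  cases hs with
  | right i l' => exact ⟨_, rfl⟩
  | left i l' => exact ⟨_, rfl⟩
  | write i a l' => exact ⟨_, rfl⟩
  | branch i a l' l'' =>
    by_cases h1 : c'.scan i = Sum.inl a
    · exact ⟨_, .inl ⟨h1, rfl⟩⟩
    · exact ⟨_, .inr ⟨h1, rfl⟩⟩
  | assign i idx g f l' hgf =>
    obtain ⟨_, x, hx, y₀, hy₀, -⟩ := hc
    obtain ⟨q, hq, hxq⟩ := h.exists_names hx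
    obtain ⟨r, hr⟩ := (hgf _ x hxq ⟨y₀, hy₀⟩).1
    exact ⟨_, q, hq, r, hr, rfl⟩
  | test idx g hg f hf l' l'' hgf =>
    obtain ⟨_, x, hx, hfx⟩ := hc
    obtain ⟨q, hq, hxq⟩ := h.exists_names hx
    have hne : (f.toMultiFun x).Nonempty := by
      rcases hfx with ⟨hfx, -⟩ | ⟨hfx, -⟩ <;> exact ⟨_, hfx⟩
    obtain ⟨w, hw⟩ := (hgf _ x hxq hne).1
    rcases hg _ w hw with rfl | rfl
    · exact ⟨_, q, hq, .inl ⟨hw, rfl⟩⟩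
    · exact ⟨_, q, hq, .inr ⟨hw, rfl⟩⟩

theorem describes_initial {p : Fin k → ℕ → σ} {x : ∀ j, Z (P.inTape j)}
    (h : ∀ j, x j ∈ (δ (P.inTape j)).toFun (p j)) :
    Describes δ ((P.onNames stm).initial p) (P.initial x) := by
  refine ⟨rfl, rfl, fun i z => ?_⟩
  simp only [GTM.initial]
  by_cases hi : z = 0 ∧ 0 < i.val ∧ i.val ≤ k
  · rw [dif_pos hi, dif_pos hi]
    refine .inr ?_
    -- The cast disappears once the tape number is a variable that can be replaced by `P.inTape j`.
    have key : ∀ (j : Fin k) (i : Fin (L + 1)) (hj : P.inTape j = i),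
        cast (congrArg Z hj) (x j) ∈ (δ i).toFun (p j) := by
      rintro j _ rfl
      exact h j
    exact key ⟨i.val - 1, by omega⟩ i (Fin.ext (Nat.sub_add_cancel hi.2.1))
  · rw [dif_neg hi, dif_neg hi]
    exact .inl rfl

/-- Replacing the statements of a machine by realizations realizes the function of the machine. -/
theorem GTM.realizes_outputs (hstm : ∀ l hl, StmtRealizes δ (stm l hl) (P.stm l hl)) :
    Realizes (fun j => (δ (P.inTape j)).toFun) (δ 0).toFun
      (fun p : Fin k → ℕ → σ => {q | (P.onNames stm).Outputs p q}) P.fn := by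
  rintro p x hpx ⟨-, ⟨hinf, hacc⟩, -⟩
  have hinit : Describes δ ((P.onNames stm).initial p) (P.initial x) := describes_initial hpx
  have hsucc : ∀ c, Relation.ReflTransGen P.Step (P.initial x) c → c.label ≠ P.lf →
      ∃ d, P.Step c d := fun c hc hl => by
    by_contra hno
    exact hl (hacc c hc hno).1
  refine ⟨?_, ?_⟩
  · by_contra hno
    -- Reachable pairs in which names describe objects. Without an output no such pair has the final
    -- label, for a final configuration of `P` is accepting and its result has a name on the tape.
    -- So each pair has a successor, and iteration gives an infinite computation of `P`, which is
    -- excluded.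
    let T := {y : (P.onNames stm).Config × P.Config //
      Relation.ReflTransGen (P.onNames stm).Step ((P.onNames stm).initial p) y.1 ∧
      Relation.ReflTransGen P.Step (P.initial x) y.2 ∧ Describes δ y.1 y.2}
    have hnext : ∀ y : T, ∃ y' : T, P.Step y.1.2 y'.1.2 := by
      rintro ⟨⟨c', c⟩, hc', hc, hcc⟩
      by_cases hl : c.label = P.lf
      · exfalso
        obtain ⟨-, z, hz⟩ := hacc c hc fun ⟨d, hl', _⟩ => hl' hl
        obtain ⟨q, hq, -⟩ := hcc.exists_name hz
        exact hno ⟨q, c', hc', hcc.label.trans hl, hq⟩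
      · obtain ⟨d, _, hd⟩ := hsucc c hc hl
        have hl' : c'.label ≠ P.lf := fun h => hl (hcc.label.symm.trans h)
        have hs : StmtRealizes δ (stm c'.label hl') (P.stm c.label hl) := by
          have hlab := hcc.label
          revert hl'
          generalize c'.label = l'  at hlab ⊢
          subst hlab
          exact fun _ => hstm _ _
        obtain ⟨d', hd'⟩ := hcc.exists_effect hs ⟨d, hd⟩
        obtain ⟨d₁, hd₁, hdd⟩ := hcc.effect hs ⟨d, hd⟩ hd'
        exact ⟨⟨(d', d₁), hc'.tail ⟨hl', hd'⟩, hc.tail ⟨hl, hd₁⟩, hdd⟩, hl, hd₁⟩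
    choose f hf using hnext
    let y₀ : T := ⟨(_, _), .refl, .refl, hinit⟩
    refine hinf ⟨fun n => (f^[n] y₀).1.2, rfl, fun n => ?_⟩
    show P.Step (f^[n] y₀).1.2 (f^[n + 1] y₀).1.2
    rw [Function.iterate_succ_apply']
    exact hf _
  · rintro q ⟨c', hc', hl, hq⟩
    suffices ∃ c, Relation.ReflTransGen P.Step (P.initial x) c ∧ Describes δ c' c by
      obtain ⟨c, hc, hcc⟩ := this
      obtain ⟨z, hz, hzq⟩ := hcc.exists_object hq
      exact ⟨z, ⟨⟨hinf, hacc⟩, c, hc, ⟨hcc.label.symm.trans hl, z, hz⟩, hz⟩, hzq⟩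
    clear hl hq
    induction hc' with
    | refl => exact ⟨_, .refl, hinit⟩
    | @tail c' d' _ hs ih =>
      obtain ⟨c, hc, hcc⟩ := ih
      obtain ⟨hl', hd'⟩ := hs
      have hl : c.label ≠ P.lf := fun h => hl' (hcc.label.trans h)
      obtain ⟨d, _, hd⟩ := hsucc c hc hl
      have hs : StmtRealizes δ (stm c'.label hl') (P.stm c.label hl) := by
        have hlab := hcc.label
        clear hd'
        revert hl'
        generalize c'.label = l' at hlab ⊢
        subst hlab
        exact fun _ => hstm _ _
      obtain ⟨d₁, hd₁, hdd⟩ := hcc.effect hs ⟨d, hd⟩ hd'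
      exact ⟨d₁, hc.tail ⟨hl, hd₁⟩, hdd⟩

end Names

/-! ### Approximation of machines on names by machines on words -/

section WordMachine

variable {σ : Type s} {zero one : σ} {k L : ℕ}

/-- Statements of a machine whose cells contain words instead of sequences. -/
inductive ApproxStmt (σ : Type s) (L : ℕ) (Γ Lab : Type v)
  /-- no action -/
  | halt
  /-- move the head of tape `i` to the right -/
  | right (i : Fin (L + 1)) (l' : Lab)
  /-- move the head of tape `i` to the left -/
  | left (i : Fin (L + 1)) (l' : Lab)
  /-- write a symbol -/
  | write (i : Fin (L + 1)) (a : Γ) (l' : Lab)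
  /-- branch on the symbol scanned -/
  | branch (i : Fin (L + 1)) (a : Γ) (l' l'' : Lab)
  /-- write the value of `h` at the current precision -/
  | assign {n : ℕ} (i : Fin (L + 1)) (idx : Fin n → Fin (L + 1))
      (h : ℕ → (Fin n → List σ) → List σ) (l' : Lab)
  /-- branch on the value of `h` at the current precision; no action if it is not known -/
  | test {n : ℕ} (idx : Fin n → Fin (L + 1)) (h : ℕ → (Fin n → List σ) → Option (List σ))
      (l' l'' : Lab)

/-- A statement on words approximates a statement on names. -/
inductive StmtApproximates {Γ Lab : Type v} :
    ApproxStmt σ L Γ Lab → GTMStmt σ zero one (fun _ : Fin (L + 1) => ℕ → σ) Γ Lab → Prop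
  | right (i l') : StmtApproximates (.right i l') (.right i l')
  | left (i l') : StmtApproximates (.left i l') (.left i l')
  | write (i a l') : StmtApproximates (.write i a l') (.write i a l')
  | branch (i a l' l'') : StmtApproximates (.branch i a l' l'') (.branch i a l' l'')
  | assign {n : ℕ} (i) (idx : Fin n → Fin (L + 1)) (h : ℕ → (Fin n → List σ) → List σ)
      (g : MultiFun (Fin n → ℕ → σ) (ℕ → σ)) (l') (H : ApproximatesSeq h g) :
      StmtApproximates (.assign i idx h l') (.assign i idx g l')
  | test {n : ℕ} (idx : Fin n → Fin (L + 1)) (h : ℕ → (Fin n → List σ) → Option (List σ))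
      (g : (Fin n → ℕ → σ) →. List σ) (hg l' l'') (H : ApproximatesWord h g.toMultiFun) :
      StmtApproximates (.test idx h l' l'') (.test idx g hg l' l'')

/-- All functions in the statement are primitive recursive. -/
def ApproxStmt.IsPrimrec [Primcodable σ] {Γ Lab : Type v} : ApproxStmt σ L Γ Lab → Prop
  | .assign _ _ h _ => Primrec₂ h
  | .test _ h _ _ => Primrec₂ h
  | _ => True

/-- The tape inscriptions and head positions of a machine whose cells contain words. -/
abbrev ApproxData (σ : Type s) (L : ℕ) (Γ : Type v) :=
  TapeLog (L + 1) (Γ ⊕ List σ) × (Fin (L + 1) → ℤ)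

variable {Γ Lab : Type v}

/-- The content of the cell scanned by the head of tape `i`. -/
def ApproxData.scan (blank : Γ) (d : ApproxData σ L Γ) (i : Fin (L + 1)) : Γ ⊕ List σ :=
  TapeLog.get (Sum.inl blank) d.1 i (d.2 i)

/-- The word in a cell; the empty word if the cell contains a symbol of the work alphabet. -/
def cellWord (x : Γ ⊕ List σ) : List σ := Sum.elim (fun _ => []) id x

/-- Write `y` under the head of tape `i`. -/
def ApproxData.setCell (d : ApproxData σ L Γ) (i : Fin (L + 1)) (y : Γ ⊕ List σ) :
    ApproxData σ L Γ :=
  (((i, d.2 i), y) :: d.1, d.2)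

open Classical in
/-- Execute a statement at label `l` with precision `t`. -/
noncomputable def approxExec (zero one : σ) (blank : Γ) (l : Lab) (t : ℕ) (d : ApproxData σ L Γ) :
    ApproxStmt σ L Γ Lab → Lab × ApproxData σ L Γ
  | .halt => (l, d)
  | .right i l' => (l', d.1, Function.update d.2 i (d.2 i + 1))
  | .left i l' => (l', d.1, Function.update d.2 i (d.2 i - 1))
  | .write i a l' => (l', d.setCell i (Sum.inl a))
  | .branch i a l' l'' => (if d.scan blank i = Sum.inl a then l' else l'', d)
  | .assign i idx h l' =>
      (l', d.setCell i (Sum.inr (h t fun j => cellWord (d.scan blank (idx j)))))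
  | .test idx h l' l'' =>
      (if h t (fun j => cellWord (d.scan blank (idx j))) = some [zero] then l'
        else if h t (fun j => cellWord (d.scan blank (idx j))) = some [one] then l'' else l, d)

theorem primrec_approxExec [Primcodable σ] [Primcodable Γ] [Primcodable Lab] (zero one : σ)
    (blank : Γ) (l : Lab) (I : ApproxStmt σ L Γ Lab) (hI : I.IsPrimrec) :
    Primrec fun x : ℕ × ApproxData σ L Γ => approxExec zero one blank l x.1 x.2 I := by
  classical
  have hlog : Primrec fun x : ℕ × ApproxData σ L Γ => x.2.1 := Primrec.fst.comp Primrec.snd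
  have hhead : Primrec fun x : ℕ × ApproxData σ L Γ => x.2.2 := Primrec.snd.comp Primrec.snd
  have hscan : ∀ i, Primrec fun x : ℕ × ApproxData σ L Γ => x.2.scan blank i := fun i =>
    (TapeLog.primrec_get _ i).comp hlog ((Primrec.apply i).comp hhead)
  have hword : Primrec (cellWord : Γ ⊕ List σ → List σ) :=
    (Primrec.sumCasesOn Primrec.id ((Primrec.const []).comp₂ Primrec₂.right)
      Primrec₂.right).of_eq fun x => by cases x <;> rfl
  have hwords : ∀ {n : ℕ} (idx : Fin n → Fin (L + 1)),
      Primrec fun x : ℕ × ApproxData σ L Γ => fun j => cellWord (x.2.scan blank (idx j)) :=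
    fun idx => Primrec.fin_curry.2 (Primrec₂.swap
      (Primrec.fin_curry₁.2 fun j => hword.comp (hscan (idx j))))
  have hset : ∀ i {y : ℕ × ApproxData σ L Γ → Γ ⊕ List σ}, Primrec y →
      Primrec fun x : ℕ × ApproxData σ L Γ => x.2.setCell i (y x) := fun i y hy =>
    Primrec.pair (Primrec.list_cons.comp (Primrec.pair (Primrec.pair (Primrec.const i)
      ((Primrec.apply i).comp hhead)) hy) hlog) hhead
  cases I with
  | halt => exact Primrec.pair (Primrec.const l) Primrec.snd
  | right i l' =>
    exact Primrec.pair (Primrec.const l') (Primrec.pair hlog ((Primrec.update i).comp hhead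
      (Primrec.int_add_one.comp ((Primrec.apply i).comp hhead))))
  | left i l' =>
    exact Primrec.pair (Primrec.const l') (Primrec.pair hlog ((Primrec.update i).comp hhead
      (Primrec.int_sub_one.comp ((Primrec.apply i).comp hhead))))
  | write i a l' =>
    exact Primrec.pair (Primrec.const l') (hset i (Primrec.const _))
  | branch i a l' l'' =>
    exact Primrec.pair (Primrec.ite (Primrec.eq.comp (hscan i) (Primrec.const _))
      (Primrec.const l') (Primrec.const l'')) Primrec.snd
  | assign i idx h l' =>
    exact Primrec.pair (Primrec.const l')
      (hset i (Primrec.sumInr.comp (Primrec₂.comp hI Primrec.fst (hwords idx))))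
  | test idx h l' l'' =>
    have hh := Primrec₂.comp hI Primrec.fst (hwords idx)
    exact Primrec.pair (Primrec.ite (Primrec.eq.comp hh (Primrec.const _))
      (Primrec.const l') (Primrec.ite (Primrec.eq.comp hh (Primrec.const _))
      (Primrec.const l'') (Primrec.const l))) Primrec.snd

/-- A cell with a word or symbol describes a cell with a sequence or symbol: symbols agree, and
words are prefixes of length at least `N`. -/
abbrev CellApprox (N : ℕ) : Γ ⊕ List σ → Γ ⊕ (ℕ → σ) → Prop :=
  Sum.LiftRel (fun a b => a = b) fun w q => SeqPrefix w q ∧ N ≤ w.length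

/-- The fold returns the content of some entry for the cell, or the blank if there is none. For the
initial inscription this makes the order of the entries irrelevant. -/
theorem TapeLog.get_induction {m : ℕ} {C : Type*} {blank : C} {l : TapeLog m C} {i : Fin m}
    {z : ℤ} {R : C → Prop} (h : ∀ x ∈ l, x.1 = (i, z) → R x.2)
    (hb : (∀ x ∈ l, x.1 ≠ (i, z)) → R blank) : R (TapeLog.get blank l i z) := by
  induction l with
  | nil => exact hb (by simp)
  | cons x l ih =>
    rw [TapeLog.get, List.foldr_cons]
    split_ifs with hx
    · exact h x (by simp) hx
    · refine ih (fun y hy => h y (by simp [hy])) fun hl => hb fun y hy => ?_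
      rcases List.mem_cons.1 hy with rfl | hy
      · exact hx
      · exact hl y hy

variable (N : GTM.{s, v, s} σ zero one k (fun _ : Fin (L + 1) => ℕ → σ))
  (prog : N.Lab → ApproxStmt σ L N.Γ N.Lab)

/-- One step of the machine on words with precision `t`. -/
noncomputable def approxStep (t : ℕ) (c : N.Lab × ApproxData σ L N.Γ) :
    N.Lab × ApproxData σ L N.Γ :=
  approxExec zero one N.blank c.1 t c.2 (prog c.1)

/-- The initial configuration of the machine on words for the input words `u`. -/
def approxInit (u : Fin k → List σ) : N.Lab × ApproxData σ L N.Γ :=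
  (N.l₀, List.ofFn fun j => ((N.inTape j, 0), Sum.inr (u j)), fun _ => 0)

open Classical in
/-- The word computed with precision `t`. -/
noncomputable def approxOutput (t : ℕ) (u : Fin k → List σ) : List σ :=
  -- The parameter `t` is both the precision of each step and the number of steps.
  if ((approxStep N prog t)^[t] (approxInit N u)).1 = N.lf then
    cellWord (TapeLog.get (Sum.inl N.blank) ((approxStep N prog t)^[t] (approxInit N u)).2.1 0 0)
  else []

variable {N prog}

theorem primrec_approxOutput [Primcodable σ] (hprog : ∀ l, (prog l).IsPrimrec) :
    Primrec₂ (approxOutput N prog) := by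
  classical
  have := N.finite_Lab
  have := N.finite_Γ
  let _ := primcodableOfFinite N.Lab
  let _ := primcodableOfFinite N.Γ
  have h : Primrec₂ fun (l : N.Lab) (x : ℕ × ApproxData σ L N.Γ) =>
      approxExec zero one N.blank l x.1 x.2 (prog l) :=
    Primrec.finite_cases fun l => primrec_approxExec zero one N.blank l (prog l) (hprog l)
  have hinit : Primrec (approxInit N) :=
    Primrec.pair (Primrec.const _) (Primrec.pair (Primrec.list_ofFn fun j =>
      Primrec.pair (Primrec.const _) (Primrec.sumInr.comp (Primrec.apply j))) (Primrec.const _))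
  have hrun : Primrec₂ fun t u => (approxStep N prog t)^[t] (approxInit N u) := by
    refine Primrec.nat_iterate Primrec.fst (hinit.comp Primrec.snd) ?_
    exact h.comp (Primrec.fst.comp Primrec.snd) (Primrec.pair (Primrec.fst.comp Primrec.fst)
      (Primrec.snd.comp Primrec.snd))
  have hword : Primrec (cellWord : N.Γ ⊕ List σ → List σ) :=
    (Primrec.sumCasesOn Primrec.id ((Primrec.const []).comp₂ Primrec₂.right)
      Primrec₂.right).of_eq fun x => by cases x <;> rfl
  exact (Primrec.ite (PrimrecRel.comp Primrec.eq (Primrec.fst.comp hrun) (Primrec.const N.lf))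
    (hword.comp ((TapeLog.primrec_get (Sum.inl N.blank) 0).comp (Primrec.fst.comp (Primrec.snd.comp hrun))
      (Primrec.const 0))) (Primrec.const [])).of_eq fun _ => by simp only [approxOutput]

/-- A configuration of the machine on words describes a configuration of the machine on names, with
words of length at least `M`. -/
structure ConfApprox (M : ℕ) (c : N.Lab × ApproxData σ L N.Γ) (d : N.Config) : Prop where
  label : c.1 = d.label
  head : c.2.2 = d.head
  tape : ∀ i z, CellApprox M (TapeLog.get (Sum.inl N.blank) c.2.1 i z) (d.tape i z)

theorem ConfApprox.mono {M M' : ℕ} (hM : M ≤ M') {c : N.Lab × ApproxData σ L N.Γ} {d : N.Config}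
    (h : ConfApprox M' c d) : ConfApprox M c d :=
  ⟨h.label, h.head, fun i z => (h.tape i z).mono (fun _ _ => id) fun _ _ h =>
    ⟨h.1, hM.trans h.2⟩⟩

theorem ConfApprox.scan {M : ℕ} {c : N.Lab × ApproxData σ L N.Γ} {d : N.Config}
    (h : ConfApprox M c d) (i : Fin (L + 1)) :
    CellApprox M (ApproxData.scan N.blank c.2 i) (d.scan i) := by
  rw [ApproxData.scan, h.head]
  exact h.tape i _

theorem CellApprox.eq_inl_iff {M : ℕ} {x : Γ ⊕ List σ} {y : Γ ⊕ (ℕ → σ)} (h : CellApprox M x y)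
    (a : Γ) : x = Sum.inl a ↔ y = Sum.inl a := by
  rcases h with ⟨rfl⟩ | h
  · exact ⟨fun h => by cases h; rfl, fun h => by cases h; rfl⟩
  · exact ⟨fun h => (Sum.inr_ne_inl h).elim, fun h => (Sum.inr_ne_inl h).elim⟩

theorem CellApprox.cellWord {M : ℕ} {x : Γ ⊕ List σ} {q : ℕ → σ}
    (h : CellApprox M x (Sum.inr q)) : SeqPrefix (cellWord x) q ∧ M ≤ (cellWord x).length := by
  rcases h with _ | h
  exact h

theorem ConfApprox.setCell {M : ℕ} {c : N.Lab × ApproxData σ L N.Γ} {d : N.Config}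
    (h : ConfApprox M c d) (i : Fin (L + 1)) {y : N.Γ ⊕ List σ} {y' : N.Γ ⊕ (ℕ → σ)}
    (hy : CellApprox M y y') (l : N.Lab) :
    ConfApprox M (l, c.2.setCell i y) ((d.setCell i y').goto l) := by
  refine ⟨rfl, h.head, fun i' z => ?_⟩
  show CellApprox M (TapeLog.get (Sum.inl N.blank) (((i, c.2.2 i), y) :: c.2.1) i' z)
    ((d.setCell i y').tape i' z)
  rw [TapeLog.get_cons, h.head]
  by_cases hi : i' = i
  · subst hi
    by_cases hz : z = d.head i'
    · subst hz
      rw [d.setCell_tape_self i' y', Function.update_self, Function.update_self]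
      exact hy
    · rw [d.setCell_tape_of_ne_head i' y' hz, Function.update_self, Function.update_of_ne hz]
      exact h.tape i' z
  · rw [d.setCell_tape_of_ne i y' hi z, Function.update_of_ne hi]
    exact h.tape i' z

theorem confApprox_init {M : ℕ} {u : Fin k → List σ} {p : Fin k → ℕ → σ}
    (hu : ∀ j, SeqPrefix (u j) (p j) ∧ M ≤ (u j).length) :
    ConfApprox M (approxInit N u) (N.initial p) := by
  refine ⟨rfl, rfl, fun i z => ?_⟩
  refine TapeLog.get_induction (R := fun x => CellApprox M x ((N.initial p).tape i z)) ?_ ?_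
  · intro x hx hxi
    simp only [approxInit, List.mem_ofFn] at hx
    obtain ⟨j, rfl⟩ := hx
    simp only [Prod.mk.injEq] at hxi
    obtain ⟨rfl, rfl⟩ := hxi
    have h1 : (N.initial p).tape (N.inTape j) 0 = Sum.inr (p j) := by
      show dite _ _ _ = _
      rw [dif_pos ⟨rfl, Nat.succ_pos _, j.2⟩]
      rfl
    rw [h1]
    exact .inr (hu j)
  · intro hx
    have h1 : (N.initial p).tape i z = Sum.inl N.blank := by
      simp only [GTM.initial]
      rw [dif_neg]
      rintro ⟨rfl, h0, hk⟩
      refine hx ((N.inTape ⟨i.val - 1, by omega⟩, 0), Sum.inr (u ⟨i.val - 1, by omega⟩)) ?_ ?_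
      · exact List.mem_ofFn.2 ⟨_, rfl⟩
      · simp only [Prod.mk.injEq, and_true]
        exact Fin.ext (Nat.sub_add_cancel h0)
    rw [h1]
    exact .inl rfl

/-- A step of the machine on names is approximated by the machine on words, unless the latter does
nothing. -/
theorem ConfApprox.exec_sound (h01 : zero ≠ one) {c : N.Lab × ApproxData σ L N.Γ}
    {d d' : N.Config} (h : ConfApprox 0 c d) {I : ApproxStmt σ L N.Γ N.Lab}
    {S : GTMStmt σ zero one (fun _ : Fin (L + 1) => ℕ → σ) N.Γ N.Lab} (hIS : StmtApproximates I S)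
    (hd : N.Effect d d' S) (t : ℕ) :
    approxExec zero one N.blank c.1 t c.2 I = c ∨
      ConfApprox 0 (approxExec zero one N.blank c.1 t c.2 I) d' := by
  have hwords : ∀ {n : ℕ} {idx : Fin n → Fin (L + 1)} {x : Fin n → ℕ → σ},
      (∀ j, d.scan (idx j) = Sum.inr (x j)) →
      ∀ j, SeqPrefix (cellWord (ApproxData.scan N.blank c.2 (idx j))) (x j) := by
    intro n idx x hx j
    have := h.scan (idx j)
    rw [hx j] at this
    exact this.cellWord.1
  cases hIS with
  | right i l' =>
    obtain rfl := hd
    exact .inr ⟨rfl, by simp only [approxExec, h.head]; rfl, h.tape⟩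
  | left i l' =>
    obtain rfl := hd
    exact .inr ⟨rfl, by simp only [approxExec, h.head]; rfl, h.tape⟩
  | write i a l' =>
    obtain rfl := hd
    exact .inr (h.setCell i (.inl rfl) l')
  | branch i a l' l'' =>
    right
    simp only [approxExec]
    rcases hd with ⟨hs, rfl⟩ | ⟨hs, rfl⟩
    · rw [if_pos (((h.scan i).eq_inl_iff a).2 hs)]
      exact ⟨rfl, h.head, h.tape⟩
    · rw [if_neg (mt ((h.scan i).eq_inl_iff a).1 hs)]
      exact ⟨rfl, h.head, h.tape⟩
  | assign i idx f g l' H =>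
    obtain ⟨x, hx, y, hy, rfl⟩ := hd
    exact .inr (h.setCell i (.inr ⟨(H x y hy).1 t _ (hwords hx), Nat.zero_le _⟩) l')
  | test idx f g hg l' l'' H =>
    obtain ⟨x, hx, hd⟩ := hd
    simp only [approxExec]
    cases hf : f t fun j => cellWord (ApproxData.scan N.blank c.2 (idx j)) with
    | none => left; simp
    | some w =>
      right
      rcases hd with ⟨hw, rfl⟩ | ⟨hw, rfl⟩
      · obtain rfl := (H x _ hw).1 t _ (hwords hx) w hf
        rw [if_pos rfl]
        exact ⟨rfl, h.head, h.tape⟩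
      · obtain rfl := (H x _ hw).1 t _ (hwords hx) w hf
        rw [if_neg (by simpa using h01.symm), if_pos rfl]
        exact ⟨rfl, h.head, h.tape⟩

/-- A step of the machine on names is approximated with any precision by the machine on words with
sufficient precision. -/
theorem ConfApprox.exec_complete (h01 : zero ≠ one) {d d' : N.Config}
    {I : ApproxStmt σ L N.Γ N.Lab}
    {S : GTMStmt σ zero one (fun _ : Fin (L + 1) => ℕ → σ) N.Γ N.Lab} (hIS : StmtApproximates I S)
    (hd : N.Effect d d' S) (M : ℕ) :
    ∃ M', ∀ t ≥ M', ∀ c, ConfApprox M' c d →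
      ConfApprox M (approxExec zero one N.blank c.1 t c.2 I) d' := by
  have hwords : ∀ {M : ℕ} {c : N.Lab × ApproxData σ L N.Γ} (_ : ConfApprox M c d)
      {n : ℕ} {idx : Fin n → Fin (L + 1)} {x : Fin n → ℕ → σ},
      (∀ j, d.scan (idx j) = Sum.inr (x j)) →
      ∀ j, SeqPrefix (cellWord (ApproxData.scan N.blank c.2 (idx j))) (x j) ∧
        M ≤ (cellWord (ApproxData.scan N.blank c.2 (idx j))).length := by
    intro M c h n idx x hx j
    have := h.scan (idx j)
    rw [hx j] at this
    exact this.cellWord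
  cases hIS with
  | right i l' =>
    obtain rfl := hd
    exact ⟨M, fun t _ c h => ⟨rfl, by simp only [approxExec, h.head]; rfl, h.tape⟩⟩
  | left i l' =>
    obtain rfl := hd
    exact ⟨M, fun t _ c h => ⟨rfl, by simp only [approxExec, h.head]; rfl, h.tape⟩⟩
  | write i a l' =>
    obtain rfl := hd
    exact ⟨M, fun t _ c h => h.setCell i (.inl rfl) l'⟩
  | branch i a l' l'' =>
    refine ⟨M, fun t _ c h => ?_⟩
    simp only [approxExec]
    rcases hd with ⟨hs, rfl⟩ | ⟨hs, rfl⟩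
    · rw [if_pos (((h.scan i).eq_inl_iff a).2 hs)]
      exact ⟨rfl, h.head, h.tape⟩
    · rw [if_neg (mt ((h.scan i).eq_inl_iff a).1 hs)]
      exact ⟨rfl, h.head, h.tape⟩
  | assign i idx f g l' H =>
    obtain ⟨x, hx, y, hy, rfl⟩ := hd
    obtain ⟨hs, hc⟩ := H x y hy
    obtain ⟨t₀, ht₀⟩ := hc M
    -- The bound `M` serves the cells left unchanged, `t₀` the argument words, so that the newly
    -- written word also has length at least `M`.
    refine ⟨max M t₀, fun t ht c h => (h.mono (le_max_left _ _)).setCell i (.inr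
      ⟨hs t _ fun j => (hwords h hx j).1, ht₀ t ((le_max_right _ _).trans ht) _ fun j =>
        ⟨(hwords h hx j).1, (le_max_right _ _).trans (hwords h hx j).2⟩⟩) l'⟩
  | test idx f g hg l' l'' H =>
    obtain ⟨x, hx, hd⟩ := hd
    obtain ⟨w, hw⟩ : ∃ w, w ∈ g x := by
      rcases hd with ⟨hw, -⟩ | ⟨hw, -⟩ <;> exact ⟨_, hw⟩
    obtain ⟨t₀, ht₀⟩ := (H x w hw).2
    refine ⟨max M t₀, fun t ht c h => ?_⟩
    have hf := ht₀ t ((le_max_right _ _).trans ht) _ fun j =>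
        ⟨(hwords h hx j).1, (le_max_right _ _).trans (hwords h hx j).2⟩
    have h' := h.mono (le_max_left _ _)
    simp only [approxExec]
    rw [hf]
    rcases hd with ⟨hw', rfl⟩ | ⟨hw', rfl⟩
    · obtain rfl := Part.mem_unique hw hw'
      rw [if_pos rfl]
      exact ⟨rfl, h'.head, h'.tape⟩
    · obtain rfl := Part.mem_unique hw hw'
      rw [if_neg (by simpa using h01.symm), if_pos rfl]
      exact ⟨rfl, h'.head, h'.tape⟩

/-- The machine on words approximates the function of the machine on names. -/
theorem approximatesSeq_approxOutput (h01 : zero ≠ one) (hlf : prog N.lf = .halt)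
    (hprog : ∀ l hl, StmtApproximates (prog l) (N.stm l hl)) :
    ApproximatesSeq (approxOutput N prog)
      (fun p : Fin k → ℕ → σ => {q | N.Outputs p q}) := by
  rintro p q ⟨d, hd, hl, hq⟩
  have hstay : ∀ t c, c.1 = N.lf → approxStep N prog t c = c := fun t c hc => by
    rw [approxStep, hc, hlf]
    exact Prod.ext hc.symm rfl
  refine ⟨fun t u hu => ?_, fun M => ?_⟩
  · have key : ∀ n, ∃ e, Relation.ReflTransGen N.Step e d ∧
        ConfApprox 0 ((approxStep N prog t)^[n] (approxInit N u)) e := by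
      intro n
      induction n with
      | zero => exact ⟨_, hd, confApprox_init fun j => ⟨hu j, Nat.zero_le _⟩⟩
      | succ n ih =>
        obtain ⟨e, he, hc⟩ := ih
        rw [Function.iterate_succ_apply']
        rcases he.cases_head with rfl | ⟨e', ⟨hle, hee⟩, he'⟩
        · rw [hstay _ _ (hc.label.trans hl)]
          exact ⟨e, he, hc⟩
        · have hp : StmtApproximates
              (prog ((approxStep N prog t)^[n] (approxInit N u)).1) (N.stm e.label hle) := by
            rw [hc.label]
            exact hprog _ _
          rcases hc.exec_sound h01 hp hee t with h | h
          · exact ⟨e, he, by rw [approxStep, h]; exact hc⟩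
          · exact ⟨e', he', h⟩
    obtain ⟨e, he, hc⟩ := key t
    unfold approxOutput
    split_ifs with hlab
    -- A configuration with the final label has no successor, so at the final label the one
    -- described is `d` itself.
    · rcases he.cases_head with rfl | ⟨e', ⟨hle, _⟩, _⟩
      · have := hc.tape 0 0
        rw [hq] at this
        exact this.cellWord.1
      · exact absurd (hc.label.symm.trans hlab) hle
    · intro i a h
      simp at h
  · have key : ∀ e, Relation.ReflTransGen N.Step (N.initial p) e → ∃ n, ∀ M, ∃ t₀, ∀ t ≥ t₀,
        ∀ u : Fin k → List σ, (∀ j, SeqPrefix (u j) (p j) ∧ t₀ ≤ (u j).length) →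
          ConfApprox M ((approxStep N prog t)^[n] (approxInit N u)) e := by
      intro e he
      induction he with
      | refl => exact ⟨0, fun M => ⟨M, fun t _ u hu => confApprox_init hu⟩⟩
      | @tail e e' _ hs ih =>
        obtain ⟨n, hn⟩ := ih
        obtain ⟨hle, hee⟩ := hs
        refine ⟨n + 1, fun M => ?_⟩
        obtain ⟨M', hM'⟩ := ConfApprox.exec_complete h01 (hprog e.label hle) hee M
        obtain ⟨t₀, ht₀⟩ := hn M'
        refine ⟨max t₀ M', fun t ht u hu => ?_⟩
        have h1 := ht₀ t ((le_max_left _ _).trans ht) u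
          fun j => ⟨(hu j).1, (le_max_left _ _).trans (hu j).2⟩
        rw [Function.iterate_succ_apply', approxStep, h1.label]
        have h2 := hM' t ((le_max_right _ _).trans ht) _ h1
        rw [h1.label] at h2
        exact h2
    obtain ⟨n, hn⟩ := key d hd
    obtain ⟨t₀, ht₀⟩ := hn M
    refine ⟨max t₀ n, fun t ht u hu => ?_⟩
    have h1 := ht₀ t ((le_max_left _ _).trans ht) u
      fun j => ⟨(hu j).1, (le_max_left _ _).trans (hu j).2⟩
    -- At the final label the machine on words stands still, so running it for `t ≥ n` steps changes
    -- nothing.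
    have h2 : (approxStep N prog t)^[t] (approxInit N u) =
        (approxStep N prog t)^[n] (approxInit N u) := by
      obtain ⟨m, rfl⟩ := Nat.exists_eq_add_of_le ((le_max_right t₀ n).trans ht)
      rw [Nat.add_comm n m] at h1 ⊢
      rw [Function.iterate_add_apply]
      exact Function.iterate_fixed (hstay _ _ (h1.label.trans hl)) m
    rw [approxOutput, h2, if_pos (h1.label.trans hl)]
    have := h1.tape 0 0
    rw [hq] at this
    exact this.cellWord.2

end WordMachine

/-! ### Closure under programming -/

section Closure

/-- A partial function that selects a value of a multi-function wherever there is one. -/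
noncomputable def MultiFun.selection {A B : Type*} (F : MultiFun A B) : A →. B := fun a =>
  ⟨(F a).Nonempty, fun h => h.some⟩

theorem MultiFun.mem_of_mem_selection {A B : Type*} {F : MultiFun A B} {a : A} {b : B}
    (hb : b ∈ F.selection.toMultiFun a) : b ∈ F a := by
  obtain ⟨h, rfl⟩ := hb
  exact h.some_mem

/-- Realization constrains every value of `f`, so any selection inherits it. Where `f` is
approximated there is no real choice: arbitrarily long common prefixes force two values to be equal.
-/
theorem Realizes.selection {n : ℕ} {X Y : Fin n → Type*} {X₀ Y₀ : Type*}
    {γ : ∀ i, MultiFun (X i) (Y i)} {γ₀ : MultiFun X₀ Y₀} {f : MultiFun (∀ i, X i) X₀}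
    {g : MultiFun (∀ i, Y i) Y₀} (h : Realizes γ γ₀ f g) :
    Realizes γ γ₀ f.selection.toMultiFun g := fun x y hxy hy =>
  ⟨⟨_, (h x y hxy hy).1, rfl⟩, fun x₀ hx₀ =>
    (h x y hxy hy).2 x₀ (MultiFun.mem_of_mem_selection hx₀)⟩

variable {σ : Type s} {zero one : σ} {k L : ℕ} {Z : Fin (L + 1) → Type u} {Γ Lab : Type v}

theorem ApproximatesSeq.selection {n : ℕ} {h : ℕ → (Fin n → List σ) → List σ}
    {g : MultiFun (Fin n → ℕ → σ) (ℕ → σ)} (hg : ApproximatesSeq h g) :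
    ApproximatesSeq h g.selection.toMultiFun := fun p q hq =>
  hg p q (MultiFun.mem_of_mem_selection hq)

theorem exists_test_realizes_approximates {δ : ∀ i, MultiRep σ (Z i)} {n : ℕ}
    {idx : Fin n → Fin (L + 1)} {f : (∀ j, Z (idx j)) →. List σ}
    (hf : ∀ x, ∀ y ∈ f x, y = [zero] ∨ y = [one]) {g : (Fin n → ℕ → σ) →. List σ}
    (hgf : Realizes (fun j => (δ (idx j)).toFun) (fun x : List σ => {x})
      g.toMultiFun f.toMultiFun)
    {h : ℕ → (Fin n → List σ) → Option (List σ)} (hg : ApproximatesWord h g.toMultiFun)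
    (l' l'' : Lab) :
    ∃ S : GTMStmt σ zero one (fun _ : Fin (L + 1) => ℕ → σ) Γ Lab,
      StmtRealizes δ S (.test idx f hf l' l'') ∧ StmtApproximates (.test idx h l' l'') S := by
  -- A realization may take other words as values on sequences that name no point of the domain,
  -- whereas a test admits only two values. Restricting `g` to where it has these values loses
  -- nothing relevant and keeps the approximation.
  let g' : (Fin n → ℕ → σ) →. List σ := fun p =>
    ⟨∃ w ∈ g p, w = [zero] ∨ w = [one], fun hw => hw.choose⟩
  have hg' : ∀ p, ∀ w ∈ g' p, w ∈ g p ∧ (w = [zero] ∨ w = [one]) := by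
    rintro p w ⟨hw, rfl⟩
    exact hw.choose_spec
  refine ⟨.test idx g' (fun p w hw => (hg' p w hw).2) l' l'',
    .test idx g' _ f hf l' l'' fun p x hpx hx => ?_,
    .test idx h g' _ l' l'' fun p w hw => hg p w (hg' p w hw).1⟩
  obtain ⟨⟨w, hw⟩, hval⟩ := hgf p x hpx hx
  obtain ⟨y, hy, rfl⟩ := hval w hw
  exact ⟨⟨_, ⟨y, hw, hf x y hy⟩, rfl⟩, fun w' hw' => hval w' (hg' p w' hw').1⟩

variable {P : GTM.{u, v, s} σ zero one k Z} {δ : ∀ i, MultiRep σ (Z i)}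

theorem GTM.IsComputable.exists_realizes_approximates [Finite σ] [Primcodable σ]
    (hP : P.IsComputable δ) (l : P.Lab) (hl : l ≠ P.lf) :
    ∃ S I, StmtRealizes δ S (P.stm l hl) ∧ StmtApproximates I S ∧ I.IsPrimrec := by
  have h := hP l hl
  cases hS : P.stm l hl with
  | right i l' => exact ⟨_, _, .right i l', .right i l', trivial⟩
  | left i l' => exact ⟨_, _, .left i l', .left i l', trivial⟩
  | write i a l' => exact ⟨_, _, .write i a l', .write i a l', trivial⟩
  | branch i a l' l'' => exact ⟨_, _, .branch i a l' l'', .branch i a l' l'', trivial⟩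
  | assign i idx f l' =>
    rw [hS] at h
    obtain ⟨g, hg, hgf⟩ := h
    obtain ⟨h, hh, hhg⟩ := hg.exists_approximates
    exact ⟨_, _, .assign i idx _ f l' hgf, .assign i idx h _ l' hhg, hh⟩
  | test idx f hf l' l'' =>
    rw [hS] at h
    obtain ⟨g, hg, hgf⟩ := h
    obtain ⟨h, hh, hhg⟩ := hg.exists_approximates
    obtain ⟨S, hS, hI⟩ := exists_test_realizes_approximates hf hgf hhg l' l''
    exact ⟨S, _, hS, hI, hh⟩

theorem GTM.IsContinuous.exists_realizes_approximates (hP : P.IsContinuous δ) (l : P.Lab)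
    (hl : l ≠ P.lf) :
    ∃ S I, StmtRealizes δ S (P.stm l hl) ∧ StmtApproximates I S := by
  have h := hP l hl
  cases hS : P.stm l hl with
  | right i l' => exact ⟨_, _, .right i l', .right i l'⟩
  | left i l' => exact ⟨_, _, .left i l', .left i l'⟩
  | write i a l' => exact ⟨_, _, .write i a l', .write i a l'⟩
  | branch i a l' l'' => exact ⟨_, _, .branch i a l' l'', .branch i a l' l''⟩
  | assign i idx f l' =>
    rw [hS] at h
    obtain ⟨g, hg, hgf⟩ := h
    obtain ⟨h, hhg⟩ := hg.exists_approximates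
    exact ⟨_, _, .assign i idx _ f l' hgf, .assign i idx h _ l' hhg⟩
  | test idx f hf l' l'' =>
    rw [hS] at h
    obtain ⟨g, hg, hgf⟩ := h
    obtain ⟨h, hhg⟩ := hg.exists_approximates
    obtain ⟨S, hS, hI⟩ := exists_test_realizes_approximates hf hgf hhg l' l''
    exact ⟨S, _, hS, hI⟩

end Closure

/-- The functions on multi-represented sets that are relatively computable (relatively continuous)
are closed under programming with generalized Turing machines. -/
theorem theoremt4 {σ : Type s} [Finite σ] {zero one : σ} (h01 : zero ≠ one) {k L : ℕ}
    {Z : Fin (L + 1) → Type u} (P : GTM.{u, v, s} σ zero one k Z)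
    (δ : ∀ i, MultiRep σ (Z i)) :
    (P.IsComputable δ → RelComputable (fun j => δ (P.inTape j)) (δ 0) P.fn) ∧
    (P.IsContinuous δ → RelContinuous (fun j => δ (P.inTape j)) (δ 0) P.fn) := by
  classical
  have : Nonempty σ := ⟨zero⟩
  refine ⟨fun hP => ?_, fun hP => ?_⟩
  · let _ := primcodableOfFinite σ
    choose stm I hstm hI hprim using hP.exists_realizes_approximates
    -- The final label carries no statement in `P`. Giving it `halt` keeps the machine on words at
    -- its result for the remaining steps.
    obtain ⟨prog, hlf, hprog⟩ : ∃ prog : P.Lab → ApproxStmt σ L P.Γ P.Lab,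
        prog P.lf = .halt ∧ ∀ l hl, prog l = I l hl :=
      ⟨fun l => if hl : l = P.lf then .halt else I l hl, dif_pos rfl, fun l hl => dif_neg hl⟩
    refine ⟨_, ApproximatesSeq.computableToSeq
      (primrec_approxOutput (N := P.onNames stm) (prog := prog) fun l => ?_)
      (approximatesSeq_approxOutput h01 hlf fun l hl => (hprog l hl).symm ▸ hI l hl).selection,
      (GTM.realizes_outputs hstm).selection⟩
    by_cases hl : l = P.lf
    · exact (congrArg ApproxStmt.IsPrimrec ((congrArg prog hl).trans hlf)).mpr trivial
    · exact (congrArg ApproxStmt.IsPrimrec (hprog l hl)).mpr (hprim l hl)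
  · choose stm I hstm hI using hP.exists_realizes_approximates
    obtain ⟨prog, hlf, hprog⟩ : ∃ prog : P.Lab → ApproxStmt σ L P.Γ P.Lab,
        prog P.lf = .halt ∧ ∀ l hl, prog l = I l hl :=
      ⟨fun l => if hl : l = P.lf then .halt else I l hl, dif_pos rfl, fun l hl => dif_neg hl⟩
    exact ⟨_, ApproximatesSeq.continuousToSeq
      (approximatesSeq_approxOutput (N := P.onNames stm) (prog := prog) h01 hlf
        fun l hl => (hprog l hl).symm ▸ hI l hl).selection, (GTM.realizes_outputs hstm).selection⟩
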